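/- Consider a discrete memoryless multiple access channel with finite input alphabets $\mathcal X_1,\mathcal X_2,\mathcal X_3$, finite output alphabet $\mathcal Y$ and transition probabilities $p(y|x_1,x_2,x_3)$. A $(2^{nR_1},2^{nR_2},2^{nR_3},n)$ code for the MAC with a cognitive relay consists of message sets $\mathcal W_i=\{1,\dots,\lceil 2^{nR_i}\rceil\}$, $i=1,2,3$, source encoders $f_i:\mathcal W_i\to\mathcal X_i^n$, $i=1,2$, a relay encoder $f_3:\mathcal W_1\times\mathcal W_2\times\mathcal W_3\to\mathcal X_3^n$ (the relay knows the messages of both sources non-causally and has a private message), and a decoder $h:\mathcal Y^n\to\mathcal W_1\times\mathcal W_2\times\mathcal W_3$. A triplet $(R_1,R_2,R_3)$ of nonnegative reals is achievable if there is a sequence of $(2^{nR_1},2^{nR_2},2^{nR_3},n)$ codes, $n\to\infty$, for which the probability that the decoded triplet differs from the transmitted one, averaged uniformly over all message triplets, tends to $0$. The capacity region is the closure of the set of all achievable triplets. Then the capacity region equals the closure of the set of all nonnegative $(R_1,R_2,R_3)$ satisfying \begin{align*} R_3 &\le I(X_3;Y|X_1,X_2,U_1,U_2,Q),\\ R_1+R_3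 &\le I(X_1,X_3;Y|X_2,U_2,Q),\\ R_2+R_3 &\le I(X_2,X_3;Y|X_1,U_1,Q),\\ R_1+R_2+R_3 &\le I(X_1,X_2,X_3;Y|Q) \end{align*} for some auxiliary random variables $U_1,U_2,Q$ with finite alphabets (of arbitrary size) and some joint distribution of the form $$p(q)\,p(x_1,u_1|q)\,p(x_2,u_2|q)\,p(x_3|u_1,u_2,q)\,p(y|x_1,x_2,x_3),$$ where mutual informations are measured in bits. -/

import Mathlib

open Filter Topology

noncomputable section

namespace CogMAC

section Information

variable {Ω α β γ : Type*}

/-- The probability `P(A = a)` when the outcome `ω` has law `μ`. -/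
def prob (μ : PMF Ω) (A : Ω → α) (a : α) : ℝ := ((μ.map A) a).toReal

/-- The conditional mutual information in bits of random variables with finite ranges,
`I(A;B|C) = ∑ p(a,b,c) log₂ (p(a,b,c) p(c) / (p(a,c) p(b,c)))`.
Terms with `p(a,b,c) = 0` vanish; in all others the four probabilities are positive. -/
def condMutualInfo [Fintype α] [Fintype β] [Fintype γ]
    (μ : PMF Ω) (A : Ω → α) (B : Ω → β) (C : Ω → γ) : ℝ :=
  ∑ a : α, ∑ b : β, ∑ c : γ,
    prob μ (fun ω => (A ω, B ω, C ω)) (a, b, c) *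
      Real.logb 2
        ((prob μ (fun ω => (A ω, B ω, C ω)) (a, b, c) * prob μ C c) /
          (prob μ (fun ω => (A ω, C ω)) (a, c) * prob μ (fun ω => (B ω, C ω)) (b, c)))

end Information

/-- A discrete memoryless channel with three inputs and one output, given by its
transition probabilities `p(y | x₁, x₂, x₃) = W x₁ x₂ x₃ y`. -/
abbrev Channel (𝒳₁ 𝒳₂ 𝒳₃ 𝒴 : Type*) := 𝒳₁ → 𝒳₂ → 𝒳₃ → PMF 𝒴

section Coding

variable {𝒳₁ 𝒳₂ 𝒳₃ 𝒴 : Type*}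

/-- The transition probability `p(yⁿ | x₁ⁿ, x₂ⁿ, x₃ⁿ)` of `n` memoryless uses. -/
def Channel.blockProb (W : Channel 𝒳₁ 𝒳₂ 𝒳₃ 𝒴) {n : ℕ}
    (x₁ : Fin n → 𝒳₁) (x₂ : Fin n → 𝒳₂) (x₃ : Fin n → 𝒳₃) (y : Fin n → 𝒴) : ℝ :=
  ∏ j : Fin n, (W (x₁ j) (x₂ j) (x₃ j) (y j)).toReal

/-- A code of block length `n` with `M₁`, `M₂`, `M₃` messages: the two sources encode their own
messages, the cognitive relay encodes all three, and the receiver decodes all three. -/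
structure Code (𝒳₁ 𝒳₂ 𝒳₃ 𝒴 : Type*) (M₁ M₂ M₃ n : ℕ) where
  enc₁ : Fin M₁ → (Fin n → 𝒳₁)
  enc₂ : Fin M₂ → (Fin n → 𝒳₂)
  enc₃ : Fin M₁ × Fin M₂ × Fin M₃ → (Fin n → 𝒳₃)
  dec : (Fin n → 𝒴) → Fin M₁ × Fin M₂ × Fin M₃

/-- The average probability of block error, for independent uniformly distributed messages. -/
def Code.errorProb [Fintype 𝒴] {M₁ M₂ M₃ n : ℕ} (c : Code 𝒳₁ 𝒳₂ 𝒳₃ 𝒴 M₁ M₂ M₃ n)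
    (W : Channel 𝒳₁ 𝒳₂ 𝒳₃ 𝒴) : ℝ :=
  (1 / ((M₁ : ℝ) * (M₂ : ℝ) * (M₃ : ℝ))) *
    ∑ w : Fin M₁ × Fin M₂ × Fin M₃, ∑ y : Fin n → 𝒴,
      if c.dec y ≠ w then W.blockProb (c.enc₁ w.1) (c.enc₂ w.2.1) (c.enc₃ w) y else 0

/-- The number `2^{nR}` of messages at rate `R`, rounded up to an integer. -/
def numMessages (R : ℝ) (n : ℕ) : ℕ := ⌈(2 : ℝ) ^ ((n : ℝ) * R)⌉₊

/-- A nonnegative rate triplet `(R₁, R₂, R₃)` is achievable if some sequence of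
`(2^{nR₁}, 2^{nR₂}, 2^{nR₃}, n)` codes has error probability tending to `0`. -/
def Channel.Achievable [Fintype 𝒴] (W : Channel 𝒳₁ 𝒳₂ 𝒳₃ 𝒴) (R : ℝ × ℝ × ℝ) : Prop :=
  0 ≤ R.1 ∧ 0 ≤ R.2.1 ∧ 0 ≤ R.2.2 ∧
    ∃ c : (n : ℕ) → Code 𝒳₁ 𝒳₂ 𝒳₃ 𝒴
        (numMessages R.1 n) (numMessages R.2.1 n) (numMessages R.2.2 n) n,
      Tendsto (fun n => (c n).errorProb W) atTop (𝓝 0)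

/-- The capacity region: the closure of the set of achievable rate triplets. -/
def Channel.capacityRegion [Fintype 𝒴] (W : Channel 𝒳₁ 𝒳₂ 𝒳₃ 𝒴) : Set (ℝ × ℝ × ℝ) :=
  closure {R | W.Achievable R}

end Coding

section Region

/-- The values of the variables `(Q, U₁, X₁, U₂, X₂, X₃, Y)`. -/
abbrev Outcome (𝒬 𝒰₁ 𝒳₁ 𝒰₂ 𝒳₂ 𝒳₃ 𝒴 : Type*) :=
  𝒬 × 𝒰₁ × 𝒳₁ × 𝒰₂ × 𝒳₂ × 𝒳₃ × 𝒴

namespace Outcome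

variable {𝒬 𝒰₁ 𝒳₁ 𝒰₂ 𝒳₂ 𝒳₃ 𝒴 : Type*}

abbrev q (ω : Outcome 𝒬 𝒰₁ 𝒳₁ 𝒰₂ 𝒳₂ 𝒳₃ 𝒴) : 𝒬 := ω.1
abbrev u₁ (ω : Outcome 𝒬 𝒰₁ 𝒳₁ 𝒰₂ 𝒳₂ 𝒳₃ 𝒴) : 𝒰₁ := ω.2.1
abbrev x₁ (ω : Outcome 𝒬 𝒰₁ 𝒳₁ 𝒰₂ 𝒳₂ 𝒳₃ 𝒴) : 𝒳₁ := ω.2.2.1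
abbrev u₂ (ω : Outcome 𝒬 𝒰₁ 𝒳₁ 𝒰₂ 𝒳₂ 𝒳₃ 𝒴) : 𝒰₂ := ω.2.2.2.1
abbrev x₂ (ω : Outcome 𝒬 𝒰₁ 𝒳₁ 𝒰₂ 𝒳₂ 𝒳₃ 𝒴) : 𝒳₂ := ω.2.2.2.2.1
abbrev x₃ (ω : Outcome 𝒬 𝒰₁ 𝒳₁ 𝒰₂ 𝒳₂ 𝒳₃ 𝒴) : 𝒳₃ := ω.2.2.2.2.2.1
abbrev y (ω : Outcome 𝒬 𝒰₁ 𝒳₁ 𝒰₂ 𝒳₂ 𝒳₃ 𝒴) : 𝒴 := ω.2.2.2.2.2.2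

end Outcome

variable {𝒬 𝒰₁ 𝒳₁ 𝒰₂ 𝒳₂ 𝒳₃ 𝒴 : Type*}

/-- The joint law `μ` of `(Q, U₁, X₁, U₂, X₂, X₃, Y)` has the form
`p(q) p(x₁,u₁|q) p(x₂,u₂|q) p(x₃|u₁,u₂,q) p(y|x₁,x₂,x₃)`. -/
def Factorizes (W : Channel 𝒳₁ 𝒳₂ 𝒳₃ 𝒴) (μ : PMF (Outcome 𝒬 𝒰₁ 𝒳₁ 𝒰₂ 𝒳₂ 𝒳₃ 𝒴)) : Prop :=
  ∃ (pQ : PMF 𝒬) (p₁ : 𝒬 → PMF (𝒳₁ × 𝒰₁)) (p₂ : 𝒬 → PMF (𝒳₂ × 𝒰₂))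
    (p₃ : 𝒰₁ → 𝒰₂ → 𝒬 → PMF 𝒳₃),
    ∀ (q : 𝒬) (u₁ : 𝒰₁) (x₁ : 𝒳₁) (u₂ : 𝒰₂) (x₂ : 𝒳₂) (x₃ : 𝒳₃) (y : 𝒴),
      μ (q, u₁, x₁, u₂, x₂, x₃, y) =
        pQ q * p₁ q (x₁, u₁) * p₂ q (x₂, u₂) * p₃ u₁ u₂ q x₃ * W x₁ x₂ x₃ y

variable [Fintype 𝒬] [Fintype 𝒰₁] [Fintype 𝒳₁] [Fintype 𝒰₂] [Fintype 𝒳₂] [Fintype 𝒳₃] [Fintype 𝒴]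

open Outcome in
/-- The four rate bounds, evaluated for the joint law `μ` of `(Q, U₁, X₁, U₂, X₂, X₃, Y)`. -/
def RateBounds (μ : PMF (Outcome 𝒬 𝒰₁ 𝒳₁ 𝒰₂ 𝒳₂ 𝒳₃ 𝒴)) (R₁ R₂ R₃ : ℝ) : Prop :=
  R₃ ≤ condMutualInfo μ x₃ y (fun ω => (x₁ ω, x₂ ω, u₁ ω, u₂ ω, q ω)) ∧
  R₁ + R₃ ≤ condMutualInfo μ (fun ω => (x₁ ω, x₃ ω)) y (fun ω => (x₂ ω, u₂ ω, q ω)) ∧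
  R₂ + R₃ ≤ condMutualInfo μ (fun ω => (x₂ ω, x₃ ω)) y (fun ω => (x₁ ω, u₁ ω, q ω)) ∧
  R₁ + R₂ + R₃ ≤ condMutualInfo μ (fun ω => (x₁ ω, x₂ ω, x₃ ω)) y q

end Region

end CogMAC

end

set_option linter.unusedSectionVars false

noncomputable section

namespace CogMAC

/-! ### Sums against product laws -/

section Sums

variable {ι α β : Type*} [Fintype ι] [DecidableEq ι] [Fintype α] [Fintype β]

/-! One flag per source, `true` when its codeword is known, indexes the four bounds. Each compares
the channel law with its average `ref` over the relay input and the unknown source inputs; `info` is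
the mean of the logarithm of their ratio.

Achievability is random coding. The sources draw sequences of pairs (x, u). For every message
triplet the relay draws a separate codeword given the time-sharing sequence and both source
codewords. The relay codewords of two distinct triplets are therefore always conditionally
independent, and only the shared source messages matter. Hence the relay rate enters every bound and
four patterns suffice. The decoder compares the likelihood ratio of each pattern with a threshold
2^(nτ). A Chernoff bound (`exists_pow_bound`) controls rejection of the true triplet, and a change
of measure (`avg_codebook_pair`, `exists_code`) controls acceptance of a wrong one.

For the converse, Q is a uniform time and each auxiliary variable is a whole source message. Given
these, the source letters are determined and the relay letter is random only through the private
message, so the law factorizes. Then n times `info` is the mean divergence of the block output law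
from a product of reference laws. Under the reference the output carries no information on the N
possible values of the unknown messages, so decoding succeeds with probability at most 1/N. The
bound log t ≥ 1 - 1/t turns this into `fano`.

Both inclusions are proved for c • R with c < 1: the slack gives strict inequalities in one
direction and absorbs the Fano terms in the other. The closures do the rest. -/

theorem sum_prod_pi (g : ι → α → ℝ) : ∑ f : ι → α, ∏ i, g i (f i) = ∏ i, ∑ x, g i x := by
  rw [Finset.prod_univ_sum, Fintype.piFinset_univ]

theorem prod_mem_stdSimplex {p : ι → α → ℝ} (hp : ∀ i, p i ∈ stdSimplex ℝ α) :
    (fun f : ι → α => ∏ i, p i (f i)) ∈ stdSimplex ℝ (ι → α) :=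
  ⟨fun f => Finset.prod_nonneg fun i _ => (hp i).1 _, by
    rw [sum_prod_pi]; exact Finset.prod_eq_one fun i _ => (hp i).2⟩

theorem sum_prod_pi_mul {p : ι → α → ℝ} (hp : ∀ i, p i ∈ stdSimplex ℝ α) (a : ι) (g : α → ℝ) :
    ∑ f : ι → α, (∏ i, p i (f i)) * g (f a) = ∑ x, p a x * g x := by
  have h (f : ι → α) : (∏ i, p i (f i)) * g (f a)
      = ∏ i, (p i (f i) * if i = a then g (f i) else 1) := by
    rw [Finset.prod_mul_distrib, Fintype.prod_ite_eq']
  simp_rw [h]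
  rw [sum_prod_pi (fun i x => p i x * if i = a then g x else 1), Fintype.prod_eq_single a]
  · simp
  · intro i hi
    simpa [hi] using (hp i).2

theorem sum_prod_pi_mul_mul {p : ι → α → ℝ} (hp : ∀ i, p i ∈ stdSimplex ℝ α) {a b : ι}
    (hab : a ≠ b) (g h : α → ℝ) :
    ∑ f : ι → α, (∏ i, p i (f i)) * (g (f a) * h (f b))
      = (∑ x, p a x * g x) * ∑ x, p b x * h x := by
  have key (f : ι → α) : (∏ i, p i (f i)) * (g (f a) * h (f b))
      = ∏ i, (p i (f i) * ((if i = a then g (f i) else 1) * if i = b then h (f i) else 1)) := by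
    simp only [Finset.prod_mul_distrib, Fintype.prod_ite_eq']
  simp_rw [key]
  rw [sum_prod_pi (fun i x => p i x * ((if i = a then g x else 1) * if i = b then h x else 1)),
    Fintype.prod_eq_mul a b hab]
  · simp [hab, hab.symm]
  · intro i hi
    simpa [hi.1, hi.2] using (hp i).2

theorem sum_prod_pi_mul₂ {p : ι → α → ℝ} (hp : ∀ i, p i ∈ stdSimplex ℝ α) {a b : ι}
    (hab : a ≠ b) (g : α → α → ℝ) :
    ∑ f : ι → α, (∏ i, p i (f i)) * g (f a) (f b)
      = ∑ x, p a x * ∑ x', p b x' * g x x' := by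
  classical
  -- Expanding over the value of `f a` turns the kernel into a sum of products of one-coordinate
  -- functions.
  have key (f : ι → α) : (∏ i, p i (f i)) * g (f a) (f b)
      = ∑ x, (∏ i, p i (f i)) * ((if f a = x then 1 else 0) * g x (f b)) := by
    simp
  simp_rw [key]
  rw [Finset.sum_comm]
  refine Finset.sum_congr rfl fun x _ => ?_
  rw [sum_prod_pi_mul_mul hp hab (fun z => if z = x then 1 else 0) (g x)]
  simp

theorem sum_mul_const_of_mem {p : α → ℝ} (hp : p ∈ stdSimplex ℝ α) (c : ℝ) :
    ∑ x, p x * c = c := by rw [← Finset.sum_mul, hp.2, one_mul]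

/-- The probabilistic method: if every value exceeded the mean, the mean would exceed itself. -/
theorem exists_le_sum_mul {p : α → ℝ} (hp : p ∈ stdSimplex ℝ α) (g : α → ℝ) :
    ∃ x, g x ≤ ∑ x, p x * g x := by
  by_contra! h
  have h1 : ∑ x, p x * (∑ x, p x * g x) < ∑ x, p x * g x := by
    refine Finset.sum_lt_sum (fun x _ => mul_le_mul_of_nonneg_left (h x).le (hp.1 x)) ?_
    by_contra! h2
    have : ∑ x, p x ≤ 0 := Finset.sum_nonpos fun x hx => by
      by_contra! h3
      have := h2 x hx
      have := h x
      nlinarith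
    linarith [hp.2]
  rw [sum_mul_const_of_mem hp] at h1
  exact lt_irrefl _ h1

end Sums

/-! ### Ensembles and their output laws -/

/-- Real-valued conditional laws of `(Q, A, B, X)` of the form `p(q) p(a|q) p(b|q) p(x|q,a,b)`. -/
structure Ensemble (Q A B X : Type*) [Fintype Q] [Fintype A] [Fintype B] [Fintype X] where
  pQ : Q → ℝ
  pA : Q → A → ℝ
  pB : Q → B → ℝ
  pX : Q → A → B → X → ℝ
  pQ_mem : pQ ∈ stdSimplex ℝ Q
  pA_mem : ∀ q, pA q ∈ stdSimplex ℝ A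
  pB_mem : ∀ q, pB q ∈ stdSimplex ℝ B
  pX_mem : ∀ q a b, pX q a b ∈ stdSimplex ℝ X

namespace Ensemble

variable {Q A B X Y : Type*} [Fintype Q] [Fintype A] [Fintype B] [Fintype X] [Fintype Y]
  (E : Ensemble Q A B X)

/-- Expectation with respect to the law of an ensemble. -/
def avg (g : Q → A → B → X → ℝ) : ℝ :=
  ∑ q, E.pQ q * ∑ a, E.pA q a * ∑ b, E.pB q b * ∑ x, E.pX q a b x * g q a b x

/-- The joint probability of `(Q, A, B, X)`. -/
def joint (z : Q × A × B × X) : ℝ :=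
  E.pQ z.1 * E.pA z.1 z.2.1 * E.pB z.1 z.2.2.1 * E.pX z.1 z.2.1 z.2.2.1 z.2.2.2

theorem avg_eq_sum (g : Q → A → B → X → ℝ) :
    E.avg g = ∑ z : Q × A × B × X, E.joint z * g z.1 z.2.1 z.2.2.1 z.2.2.2 := by
  simp only [avg, joint, Fintype.sum_prod_type, Finset.mul_sum, mul_assoc]

theorem joint_mem : E.joint ∈ stdSimplex ℝ (Q × A × B × X) := by
  refine ⟨fun z => ?_, ?_⟩
  · have := E.pQ_mem.1 z.1
    have := (E.pA_mem z.1).1 z.2.1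
    have := (E.pB_mem z.1).1 z.2.2.1
    have := (E.pX_mem z.1 z.2.1 z.2.2.1).1 z.2.2.2
    unfold joint; positivity
  · have := E.avg_eq_sum fun _ _ _ _ => 1
    simp only [mul_one] at this
    rw [← this]
    simp [avg, (E.pX_mem _ _ _).2, (E.pB_mem _).2, (E.pA_mem _).2, E.pQ_mem.2]

theorem avg_mono {g h : Q → A → B → X → ℝ} (H : ∀ q a b x, g q a b x ≤ h q a b x) :
    E.avg g ≤ E.avg h := by
  rw [avg_eq_sum, avg_eq_sum]
  exact Finset.sum_le_sum fun z _ => mul_le_mul_of_nonneg_left (H _ _ _ _) (E.joint_mem.1 z)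

theorem avg_sum {ι : Type*} (s : Finset ι) (g : ι → Q → A → B → X → ℝ) :
    E.avg (fun q a b x => ∑ i ∈ s, g i q a b x) = ∑ i ∈ s, E.avg (g i) := by
  simp only [avg_eq_sum, Finset.mul_sum]
  rw [Finset.sum_comm]

theorem avg_add (g h : Q → A → B → X → ℝ) :
    E.avg (fun q a b x => g q a b x + h q a b x) = E.avg g + E.avg h := by
  simp only [avg_eq_sum, mul_add, Finset.sum_add_distrib]

theorem avg_const_mul (c : ℝ) (g : Q → A → B → X → ℝ) :
    E.avg (fun q a b x => c * g q a b x) = c * E.avg g := by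
  simp only [avg_eq_sum, Finset.mul_sum]
  exact Finset.sum_congr rfl fun _ _ => by ring

theorem avg_const (c : ℝ) : E.avg (fun _ _ _ _ => c) = c := by
  rw [avg_eq_sum, sum_mul_const_of_mem E.joint_mem]

theorem exists_le_avg (g : Q → A → B → X → ℝ) : ∃ q a b x, g q a b x ≤ E.avg g := by
  rw [avg_eq_sum]
  obtain ⟨z, hz⟩ := exists_le_sum_mul E.joint_mem fun z => g z.1 z.2.1 z.2.2.1 z.2.2.2
  exact ⟨_, _, _, _, hz⟩

/-- The conditional law of the channel output given the time-sharing variable and both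
source inputs. -/
def out (V : A → B → X → Y → ℝ) (q : Q) (a : A) (b : B) (y : Y) : ℝ :=
  ∑ x, E.pX q a b x * V a b x y

/-- The conditional law of the channel output given the time-sharing variable and those of the two
source inputs whose flag is `true`. -/
def ref (V : A → B → X → Y → ℝ) : Bool → Bool → Q → A → B → Y → ℝ
  | true, true => fun q a b y => E.out V q a b y
  | false, true => fun q _ b y => ∑ a, E.pA q a * E.out V q a b y
  | true, false => fun q a _ y => ∑ b, E.pB q b * E.out V q a b y
  | false, false => fun q _ _ y => ∑ a, E.pA q a * ∑ b, E.pB q b * E.out V q a b y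

theorem out_mem {V : A → B → X → Y → ℝ} (hV : ∀ a b x, V a b x ∈ stdSimplex ℝ Y) (q : Q) (a : A)
    (b : B) : E.out V q a b ∈ stdSimplex ℝ Y := by
  refine ⟨fun y => Finset.sum_nonneg fun x _ => mul_nonneg ((E.pX_mem q a b).1 x) ((hV a b x).1 y),
    ?_⟩
  unfold out
  rw [Finset.sum_comm]
  simp [← Finset.mul_sum, (hV _ _ _).2, (E.pX_mem q a b).2]

theorem ref_mem {V : A → B → X → Y → ℝ} (hV : ∀ a b x, V a b x ∈ stdSimplex ℝ Y) (k₁ k₂ : Bool)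
    (q : Q) (a : A) (b : B) : E.ref V k₁ k₂ q a b ∈ stdSimplex ℝ Y := by
  have hA := fun a => (E.pA_mem q).1 a
  have hB := fun b => (E.pB_mem q).1 b
  have ho := fun a b y => (E.out_mem hV q a b).1 y
  cases k₁ <;> cases k₂
  · refine ⟨fun y => Finset.sum_nonneg fun a _ => mul_nonneg (hA a) (Finset.sum_nonneg
      fun b _ => mul_nonneg (hB b) (ho a b y)), ?_⟩
    simp only [ref]
    rw [Finset.sum_comm]
    simp only [← Finset.mul_sum]
    refine (Finset.sum_congr rfl fun a _ => ?_).trans (E.pA_mem q).2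
    rw [Finset.sum_comm]
    simp [← Finset.mul_sum, (E.out_mem hV q _ _).2, (E.pB_mem q).2]
  · refine ⟨fun y => Finset.sum_nonneg fun a _ => mul_nonneg (hA a) (ho a b y), ?_⟩
    simp only [ref]
    rw [Finset.sum_comm]
    simp [← Finset.mul_sum, (E.out_mem hV q _ _).2, (E.pA_mem q).2]
  · refine ⟨fun y => Finset.sum_nonneg fun b _ => mul_nonneg (hB b) (ho a b y), ?_⟩
    simp only [ref]
    rw [Finset.sum_comm]
    simp [← Finset.mul_sum, (E.out_mem hV q _ _).2, (E.pB_mem q).2]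
  · exact E.out_mem hV q a b

/-! ### Random codebooks and the one-shot coding bound -/

/-- The random codebook with message sets `I`, `J`, `K`: codewords of the sources are drawn
independently given `q`, those of the relay conditionally on the codewords of the sources. -/
def codebook (I J K : Type*) [Fintype I] [Fintype J] [Fintype K] [DecidableEq I] [DecidableEq J]
    [DecidableEq K] : Ensemble Q (I → A) (J → B) (I × J × K → X) where
  pQ := E.pQ
  pA q f := ∏ i, E.pA q (f i)
  pB q f := ∏ j, E.pB q (f j)
  pX q f g h := ∏ w, E.pX q (f w.1) (g w.2.1) (h w)
  pQ_mem := E.pQ_mem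
  pA_mem q := prod_mem_stdSimplex fun _ => E.pA_mem q
  pB_mem q := prod_mem_stdSimplex fun _ => E.pB_mem q
  pX_mem q _ _ := prod_mem_stdSimplex fun _ => E.pX_mem q _ _

section Codebook

variable {I J K : Type*} [Fintype I] [Fintype J] [Fintype K] [DecidableEq I] [DecidableEq J]
    [DecidableEq K]

/-- All codewords not attached to the fixed triplet integrate to one. -/
theorem avg_codebook (g : Q → A → B → X → ℝ) (w : I × J × K) :
    (E.codebook I J K).avg (fun q fa fb fx => g q (fa w.1) (fb w.2.1) (fx w)) = E.avg g := by
  simp only [avg, codebook]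
  refine Finset.sum_congr rfl fun q _ => ?_
  congr 1
  rw [← sum_prod_pi_mul (fun _ : I => E.pA_mem q) w.1
    (fun a => ∑ b, E.pB q b * ∑ x, E.pX q a b x * g q a b x)]
  refine Finset.sum_congr rfl fun fa _ => ?_
  congr 1
  rw [← sum_prod_pi_mul (fun _ : J => E.pB_mem q) w.2.1
    (fun b => ∑ x, E.pX q (fa w.1) b x * g q (fa w.1) b x)]
  refine Finset.sum_congr rfl fun fb _ => ?_
  congr 1
  exact sum_prod_pi_mul (fun w : I × J × K => E.pX_mem q (fa w.1) (fb w.2.1)) w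
    (g q (fa w.1) (fb w.2.1))

/-- The output is driven by `w` while the test is run on `w'`. The two relay codewords are
conditionally independent even if both source messages agree. Averaging out the codewords that
belong to `w` alone leaves `ref`, its flags marking the shared source messages. -/
theorem avg_codebook_pair (V : A → B → X → Y → ℝ) (g : Q → A → B → X → Y → ℝ) {w w' : I × J × K}
    (hw : w ≠ w') :
    (E.codebook I J K).avg (fun q fa fb fx =>
        ∑ y, V (fa w.1) (fb w.2.1) (fx w) y * g q (fa w'.1) (fb w'.2.1) (fx w') y)
      = E.avg fun q a b x =>
        ∑ y, E.ref V (decide (w.1 = w'.1)) (decide (w.2.1 = w'.2.1)) q a b y * g q a b x y := by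
  have inner (q : Q) (fa : I → A) (fb : J → B) :
      ∑ fx : I × J × K → X, (∏ w, E.pX q (fa w.1) (fb w.2.1) (fx w)) *
        ∑ y, V (fa w.1) (fb w.2.1) (fx w) y * g q (fa w'.1) (fb w'.2.1) (fx w') y
      = ∑ x', E.pX q (fa w'.1) (fb w'.2.1) x' * ∑ y, E.out V q (fa w.1) (fb w.2.1) y *
          g q (fa w'.1) (fb w'.2.1) x' y := by
    rw [sum_prod_pi_mul₂ (fun w : I × J × K => E.pX_mem q (fa w.1) (fb w.2.1)) hw
      (fun x x' => ∑ y, V (fa w.1) (fb w.2.1) x y * g q (fa w'.1) (fb w'.2.1) x' y)]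
    simp only [out, Finset.mul_sum, Finset.sum_mul]
    rw [Finset.sum_comm]
    refine Finset.sum_congr rfl fun x' _ => ?_
    rw [Finset.sum_comm]
    exact Finset.sum_congr rfl fun y _ => Finset.sum_congr rfl fun x _ => by ring
  simp only [avg, codebook]
  refine Finset.sum_congr rfl fun q _ => ?_
  congr 1
  simp_rw [inner]
  have innerB (fa : I → A) :
      ∑ fb : J → B, (∏ j, E.pB q (fb j)) * ∑ x', E.pX q (fa w'.1) (fb w'.2.1) x' *
          ∑ y, E.out V q (fa w.1) (fb w.2.1) y * g q (fa w'.1) (fb w'.2.1) x' y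
      = ∑ b', E.pB q b' * ∑ x', E.pX q (fa w'.1) b' x' * ∑ y,
          (if w.2.1 = w'.2.1 then E.out V q (fa w.1) b' y
            else ∑ b, E.pB q b * E.out V q (fa w.1) b y) * g q (fa w'.1) b' x' y := by
    split_ifs with h
    · rw [h]
      exact sum_prod_pi_mul (fun _ : J => E.pB_mem q) w'.2.1 (fun b => ∑ x',
        E.pX q (fa w'.1) b x' * ∑ y, E.out V q (fa w.1) b y * g q (fa w'.1) b x' y)
    · rw [sum_prod_pi_mul₂ (fun _ : J => E.pB_mem q) h (fun b b' => ∑ x',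
        E.pX q (fa w'.1) b' x' * ∑ y, E.out V q (fa w.1) b y * g q (fa w'.1) b' x' y)]
      simp only [Finset.mul_sum, Finset.sum_mul]
      rw [Finset.sum_comm]
      refine Finset.sum_congr rfl fun b' _ => ?_
      rw [Finset.sum_comm]
      refine Finset.sum_congr rfl fun x' _ => ?_
      rw [Finset.sum_comm]
      exact Finset.sum_congr rfl fun y _ => Finset.sum_congr rfl fun b _ => by ring
  simp_rw [innerB]
  by_cases h : w.1 = w'.1
  · rw [h]
    rw [sum_prod_pi_mul (fun _ : I => E.pA_mem q) w'.1 (fun a => ∑ b', E.pB q b' * ∑ x',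
      E.pX q a b' x' * ∑ y, (if w.2.1 = w'.2.1 then E.out V q a b' y
            else ∑ b, E.pB q b * E.out V q a b y) * g q a b' x' y)]
    by_cases h2 : w.2.1 = w'.2.1 <;> simp [h2, ref]
  · rw [sum_prod_pi_mul₂ (fun _ : I => E.pA_mem q) h (fun a a' => ∑ b', E.pB q b' * ∑ x',
      E.pX q a' b' x' * ∑ y, (if w.2.1 = w'.2.1 then E.out V q a b' y
            else ∑ b, E.pB q b * E.out V q a b y) * g q a' b' x' y)]
    have hr (b : B) (y : Y) (a' : A) :
        E.ref V (decide (w.1 = w'.1)) (decide (w.2.1 = w'.2.1)) q a' b y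
        = ∑ a, E.pA q a * (if w.2.1 = w'.2.1 then E.out V q a b y
            else ∑ b, E.pB q b * E.out V q a b y) := by
      by_cases h2 : w.2.1 = w'.2.1 <;> simp [h, h2, ref]
    simp_rw [hr]
    simp only [Finset.sum_mul, Finset.mul_sum]
    rw [Finset.sum_comm]
    refine Finset.sum_congr rfl fun a' _ => ?_
    rw [Finset.sum_comm]
    refine Finset.sum_congr rfl fun b' _ => ?_
    rw [Finset.sum_comm]
    refine Finset.sum_congr rfl fun x' _ => ?_
    rw [Finset.sum_comm]
    exact Finset.sum_congr rfl fun y _ => Finset.sum_congr rfl fun a _ => by ring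

open Classical in
/-- The random coding bound for a single use of a channel. -/
theorem exists_code [Nonempty I] [Nonempty J] [Nonempty K] {V : A → B → X → Y → ℝ}
    (hV : ∀ a b x, V a b x ∈ stdSimplex ℝ Y) (S : Q → A → B → X → Y → Prop)
    (δ : Bool → Bool → ℝ)
    (hS : ∀ k₁ k₂ q a b x y, S q a b x y → E.ref V k₁ k₂ q a b y ≤ δ k₁ k₂ * V a b x y)
    (hδ : ∀ k₁ k₂, 0 ≤ δ k₁ k₂) :
    ∃ (fa : I → A) (fb : J → B) (fx : I × J × K → X) (dec : Y → I × J × K),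
      ∑ w, ∑ y, (if dec y ≠ w then V (fa w.1) (fb w.2.1) (fx w) y else 0) ≤
        ∑ w : I × J × K, ((E.avg fun q a b x => ∑ y, V a b x y * if S q a b x y then 0 else 1) +
          ∑ w' with w ≠ w', δ (decide (w.1 = w'.1)) (decide (w.2.1 = w'.2.1))) := by
  -- The union bound: the true triplet fails the test, or another one passes it.
  let F (q : Q) (fa : I → A) (fb : J → B) (fx : I × J × K → X) : ℝ :=
    ∑ w : I × J × K, ((∑ y, V (fa w.1) (fb w.2.1) (fx w) y *
        if S q (fa w.1) (fb w.2.1) (fx w) y then 0 else 1) +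
      ∑ w' with w ≠ w', ∑ y, V (fa w.1) (fb w.2.1) (fx w) y *
        if S q (fa w'.1) (fb w'.2.1) (fx w') y then 1 else 0)
  obtain ⟨q, fa, fb, fx, h⟩ := (E.codebook I J K).exists_le_avg F
  -- Any passing triplet may be chosen. The default is harmless: it is used only if the true triplet
  -- fails too, which `F` already counts.
  let dec (y : Y) : I × J × K :=
    if h : ∃ w, S q (fa w.1) (fb w.2.1) (fx w) y then h.choose else Classical.arbitrary _
  refine ⟨fa, fb, fx, dec, ?_⟩
  refine le_trans ?_ (h.trans ?_)
  · refine Finset.sum_le_sum fun w _ => ?_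
    rw [Finset.sum_comm, ← Finset.sum_add_distrib]
    refine Finset.sum_le_sum fun y _ => ?_
    have hv := (hV (fa w.1) (fb w.2.1) (fx w)).1 y
    rw [← Finset.mul_sum, ← mul_add]
    have hnn (w' : I × J × K) :
        (0 : ℝ) ≤ if S q (fa w'.1) (fb w'.2.1) (fx w') y then 1 else 0 := by
      split_ifs <;> norm_num
    split_ifs with h1 h2
    · have hex : ∃ w, S q (fa w.1) (fb w.2.1) (fx w) y := ⟨w, h2⟩
      have hd : dec y = hex.choose := dif_pos hex
      refine le_mul_of_one_le_right hv ?_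
      rw [zero_add]
      refine le_trans ?_ (Finset.single_le_sum (fun w' _ => hnn w') (a := dec y)
        (by simpa using Ne.symm h1))
      rw [if_pos]
      rw [hd]
      exact hex.choose_spec
    · refine le_mul_of_one_le_right hv ?_
      linarith [Finset.sum_nonneg fun w' (_ : w' ∈ Finset.univ.filter (w ≠ ·)) => hnn w']
    · exact mul_nonneg hv (add_nonneg le_rfl (Finset.sum_nonneg fun w' _ => hnn w'))
    · exact mul_nonneg hv (add_nonneg zero_le_one (Finset.sum_nonneg fun w' _ => hnn w'))
  · simp only [F]
    rw [avg_sum]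
    refine Finset.sum_le_sum fun w _ => ?_
    rw [avg_add]
    refine add_le_add (le_of_eq ?_) ?_
    · exact E.avg_codebook (fun q a b x => ∑ y, V a b x y * if S q a b x y then 0 else 1) w
    · rw [avg_sum]
      refine Finset.sum_le_sum fun w' hw' => ?_
      rw [E.avg_codebook_pair V (fun q a b x y => if S q a b x y then 1 else 0)
        (by simpa using hw')]
      refine le_trans (E.avg_mono (h := fun _ _ _ _ =>
        δ (decide (w.1 = w'.1)) (decide (w.2.1 = w'.2.1))) fun q a b x => ?_) (E.avg_const _).le
      -- Change of measure: on accepted outputs the reference is at most δ times the channel law,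
      -- whose total mass is one.
      calc _ ≤ ∑ y, δ (decide (w.1 = w'.1)) (decide (w.2.1 = w'.2.1)) * V a b x y := by
            refine Finset.sum_le_sum fun y _ => ?_
            split_ifs with hs
            · rw [mul_one]; exact hS _ _ _ _ _ _ _ hs
            · rw [mul_zero]; exact mul_nonneg (hδ _ _) ((hV a b x).1 y)
        _ = _ := by rw [← Finset.mul_sum, (hV a b x).2, mul_one]

end Codebook

end Ensemble

/-! ### Chernoff bounds for memoryless repetitions -/

/-- The moment generating function equals 1 at s = 0 and has the negative mean as its derivative
there, so it is below 1 for some small s > 0. -/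
theorem exists_sum_mul_exp_lt_one {ι : Type*} [Fintype ι] {p : ι → ℝ} (hp : p ∈ stdSimplex ℝ ι)
    {z : ι → ℝ} (hz : ∑ i, p i * z i < 0) : ∃ s > 0, ∑ i, p i * Real.exp (s * z i) < 1 := by
  have hd : HasDerivAt (fun s : ℝ => ∑ i, p i * Real.exp (s * z i)) (∑ i, p i * z i) 0 := by
    refine HasDerivAt.fun_sum fun i _ => ?_
    have := (((hasDerivAt_id (0 : ℝ)).mul_const (z i)).exp).const_mul (p i)
    simpa using this
  have hslope := hasDerivAt_iff_tendsto_slope_zero.1 hd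
  have hev : ∀ᶠ t in 𝓝[>] (0 : ℝ), t⁻¹ • ((∑ i, p i * Real.exp ((0 + t) * z i)) -
      ∑ i, p i * Real.exp (0 * z i)) < 0 :=
    (hslope.mono_left (nhdsWithin_mono _ fun x hx => ne_of_gt hx)).eventually_lt_const hz
  obtain ⟨s, hs, hs0⟩ := (hev.and self_mem_nhdsWithin).exists
  refine ⟨s, hs0, ?_⟩
  have hs0' : (0 : ℝ) < s := hs0
  simp only [zero_add, zero_mul, Real.exp_zero, mul_one, hp.2, smul_eq_mul] at hs
  by_contra! h
  have := mul_nonneg (inv_nonneg.2 hs0'.le) (sub_nonneg.2 h)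
  linarith

/-- The transition probability of repeated memoryless uses of a channel. -/
def powChannel {A B X Y : Type*} (V : A → B → X → Y → ℝ) (n : ℕ) (a : Fin n → A) (b : Fin n → B)
    (x : Fin n → X) (y : Fin n → Y) : ℝ :=
  ∏ j, V (a j) (b j) (x j) (y j)

theorem powChannel_mem {A B X Y : Type*} [Fintype Y] {V : A → B → X → Y → ℝ}
    (hV : ∀ a b x, V a b x ∈ stdSimplex ℝ Y) (n : ℕ) (a : Fin n → A) (b : Fin n → B)
    (x : Fin n → X) : powChannel V n a b x ∈ stdSimplex ℝ (Fin n → Y) :=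
  prod_mem_stdSimplex fun j => hV (a j) (b j) (x j)

namespace Ensemble

variable {Q A B X Y : Type*} [Fintype Q] [Fintype A] [Fintype B] [Fintype X] [Fintype Y]
  (E : Ensemble Q A B X)

/-- Independent repetitions of an ensemble. -/
def pow (n : ℕ) : Ensemble (Fin n → Q) (Fin n → A) (Fin n → B) (Fin n → X) where
  pQ q := ∏ j, E.pQ (q j)
  pA q a := ∏ j, E.pA (q j) (a j)
  pB q b := ∏ j, E.pB (q j) (b j)
  pX q a b x := ∏ j, E.pX (q j) (a j) (b j) (x j)
  pQ_mem := prod_mem_stdSimplex fun _ => E.pQ_mem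
  pA_mem q := prod_mem_stdSimplex fun j => E.pA_mem (q j)
  pB_mem q := prod_mem_stdSimplex fun j => E.pB_mem (q j)
  pX_mem q a b := prod_mem_stdSimplex fun j => E.pX_mem (q j) (a j) (b j)

theorem avg_pow_prod (n : ℕ) (g : Q → A → B → X → ℝ) :
    (E.pow n).avg (fun q a b x => ∏ j, g (q j) (a j) (b j) (x j)) = E.avg g ^ n := by
  simp only [avg, pow, ← Finset.prod_mul_distrib]
  have h1 (q : Fin n → Q) (a : Fin n → A) (b : Fin n → B) :=
    sum_prod_pi fun j x => E.pX (q j) (a j) (b j) x * g (q j) (a j) (b j) x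
  simp only [h1, ← Finset.prod_mul_distrib]
  have h2 (q : Fin n → Q) (a : Fin n → A) :=
    sum_prod_pi fun j b => E.pB (q j) b * ∑ x, E.pX (q j) (a j) b x * g (q j) (a j) b x
  simp only [h2, ← Finset.prod_mul_distrib]
  have h3 (q : Fin n → Q) :=
    sum_prod_pi fun j a => E.pA (q j) a * ∑ b, E.pB (q j) b *
      ∑ x, E.pX (q j) a b x * g (q j) a b x
  simp only [h3, ← Finset.prod_mul_distrib]
  rw [sum_prod_pi fun (_ : Fin n) q => E.pQ q * ∑ a, E.pA q a * ∑ b, E.pB q b *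
      ∑ x, E.pX q a b x * g q a b x]
  simp

theorem out_pow (V : A → B → X → Y → ℝ) (n : ℕ) (q : Fin n → Q) (a : Fin n → A) (b : Fin n → B)
    (y : Fin n → Y) :
    (E.pow n).out (powChannel V n) q a b y = ∏ j, E.out V (q j) (a j) (b j) (y j) := by
  simp only [out, pow, powChannel, ← Finset.prod_mul_distrib]
  exact sum_prod_pi fun j x => E.pX (q j) (a j) (b j) x * V (a j) (b j) x (y j)

theorem ref_pow (V : A → B → X → Y → ℝ) (n : ℕ) (k₁ k₂ : Bool) (q : Fin n → Q) (a : Fin n → A)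
    (b : Fin n → B) (y : Fin n → Y) :
    (E.pow n).ref (powChannel V n) k₁ k₂ q a b y
      = ∏ j, E.ref V k₁ k₂ (q j) (a j) (b j) (y j) := by
  have hA (g : Fin n → A → ℝ) : ∑ a, (E.pow n).pA q a * ∏ j, g j (a j)
      = ∏ j, ∑ a, E.pA (q j) a * g j a := by
    simp only [pow, ← Finset.prod_mul_distrib]
    exact sum_prod_pi fun j a => E.pA (q j) a * g j a
  have hB (g : Fin n → B → ℝ) : ∑ b, (E.pow n).pB q b * ∏ j, g j (b j)
      = ∏ j, ∑ b, E.pB (q j) b * g j b := by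
    simp only [pow, ← Finset.prod_mul_distrib]
    exact sum_prod_pi fun j b => E.pB (q j) b * g j b
  cases k₁ <;> cases k₂ <;> simp only [ref, out_pow]
  · rw [← hA fun j a => ∑ b, E.pB (q j) b * E.out V (q j) a b (y j)]
    refine Finset.sum_congr rfl fun a _ => ?_
    rw [← hB fun j b => E.out V (q j) (a j) b (y j)]
  · rw [← hA fun j a => E.out V (q j) a (b j) (y j)]
  · rw [← hB fun j b => E.out V (q j) (a j) b (y j)]

/-- The conditional mutual information in bits between the inputs and the output, given the
time-sharing variable and those of the two source inputs whose flag is `true`. -/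
def info (V : A → B → X → Y → ℝ) (k₁ k₂ : Bool) : ℝ :=
  E.avg fun q a b x => ∑ y, V a b x y * Real.logb 2 (V a b x y / E.ref V k₁ k₂ q a b y)

theorem exists_avg_exp_lt_one {V : A → B → X → Y → ℝ} (hV : ∀ a b x, V a b x ∈ stdSimplex ℝ Y)
    {z : Q → A → B → X → Y → ℝ} (hz : E.avg (fun q a b x => ∑ y, V a b x y * z q a b x y) < 0) :
    ∃ s > 0, E.avg (fun q a b x => ∑ y, V a b x y * Real.exp (s * z q a b x y)) < 1 := by
  have key (f : Q → A → B → X → Y → ℝ) : E.avg (fun q a b x => ∑ y, V a b x y * f q a b x y)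
      = ∑ w : (Q × A × B × X) × Y, (E.joint w.1 * V w.1.2.1 w.1.2.2.1 w.1.2.2.2 w.2) *
        f w.1.1 w.1.2.1 w.1.2.2.1 w.1.2.2.2 w.2 := by
    simp only [avg_eq_sum, Fintype.sum_prod_type, Finset.mul_sum, mul_assoc]
  simp only [key] at hz ⊢
  refine exists_sum_mul_exp_lt_one ⟨fun w => mul_nonneg (E.joint_mem.1 _) ((hV _ _ _).1 _), ?_⟩ hz
  rw [Fintype.sum_prod_type]
  simp [← Finset.mul_sum, (hV _ _ _).2, E.joint_mem.2]

-- The logarithm of the block likelihood ratio is a sum of letter terms with mean `info` > τ. The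
-- indicator that it falls below nτ is dominated by an exponential of the deficit, whose average is
-- an n-th power of a number below 1.
open Classical in
theorem exists_pow_bound {V : A → B → X → Y → ℝ} (hV : ∀ a b x, V a b x ∈ stdSimplex ℝ Y)
    {k₁ k₂ : Bool} {τ : ℝ} (hτ : τ < E.info V k₁ k₂) :
    ∃ c : ℝ, 0 ≤ c ∧ c < 1 ∧ ∀ n : ℕ, (E.pow n).avg (fun q a b x =>
      ∑ y, powChannel V n a b x y * if powChannel V n a b x y <
        2 ^ (n * τ) * (E.pow n).ref (powChannel V n) k₁ k₂ q a b y then 1 else 0) ≤ c ^ n := by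
  -- The deficit of one letter in natural units; its mean is log 2 · (τ - info) < 0.
  let z (q : Q) (a : A) (b : B) (x : X) (y : Y) : ℝ :=
    Real.log 2 * (τ - Real.logb 2 (V a b x y / E.ref V k₁ k₂ q a b y))
  have hlog2 : 0 < Real.log 2 := Real.log_pos one_lt_two
  have hz : E.avg (fun q a b x => ∑ y, V a b x y * z q a b x y) < 0 := by
    have h1 : E.avg (fun q a b x => ∑ y, V a b x y * z q a b x y)
        = Real.log 2 * (τ + (-1) * E.info V k₁ k₂) := by
      rw [info, ← avg_const_mul]
      nth_rw 1 [← E.avg_const τ]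
      rw [← avg_add, ← avg_const_mul]
      congr 1
      funext q a b x
      nth_rw 1 [← sum_mul_const_of_mem (hV a b x) τ]
      rw [Finset.mul_sum, ← Finset.sum_add_distrib, Finset.mul_sum]
      exact Finset.sum_congr rfl fun y _ => by simp only [z]; ring
    rw [h1]
    exact mul_neg_of_pos_of_neg hlog2 (by linarith)
  obtain ⟨s, hs, hlt⟩ := E.exists_avg_exp_lt_one hV hz
  refine ⟨_, ?_, hlt, fun n => ?_⟩
  · rw [← E.avg_const 0]
    exact E.avg_mono fun q a b x => Finset.sum_nonneg fun y _ =>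
      mul_nonneg ((hV a b x).1 y) (Real.exp_pos _).le
  rw [← avg_pow_prod]
  refine avg_mono _ fun q a b x => ?_
  rw [← sum_prod_pi fun j y => V (a j) (b j) (x j) y *
    Real.exp (s * z (q j) (a j) (b j) (x j) y)]
  refine Finset.sum_le_sum fun y _ => ?_
  rw [Finset.prod_mul_distrib]
  change powChannel V n a b x y * _ ≤ powChannel V n a b x y * _
  have hnn := (powChannel_mem hV n a b x).1 y
  rcases hnn.eq_or_lt with h0 | hpos
  · rw [← h0, zero_mul, zero_mul]
  refine mul_le_mul_of_nonneg_left ?_ hnn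
  split_ifs with hlt
  swap
  · exact Finset.prod_nonneg fun j _ => (Real.exp_pos _).le
  rw [ref_pow] at hlt
  have hVj (j : Fin n) : 0 < V (a j) (b j) (x j) (y j) :=
    ((hV _ _ _).1 _).lt_of_ne fun h => hpos.ne' (Finset.prod_eq_zero (Finset.mem_univ j) h.symm)
  -- A vanishing reference could not exceed the positive likelihood, so every logarithm below has a
  -- positive argument.
  have hrpos : 0 < ∏ j, E.ref V k₁ k₂ (q j) (a j) (b j) (y j) := by
    by_contra! h
    have := mul_nonpos_of_nonneg_of_nonpos
      (Real.rpow_nonneg zero_le_two (n * τ)) h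
    linarith
  have hrj (j : Fin n) : 0 < E.ref V k₁ k₂ (q j) (a j) (b j) (y j) :=
    ((E.ref_mem hV _ _ _ _ _).1 _).lt_of_ne fun h =>
      hrpos.ne' (Finset.prod_eq_zero (Finset.mem_univ j) h.symm)
  rw [← Real.exp_sum]
  refine Real.one_le_exp ?_
  rw [← Finset.mul_sum]
  refine mul_nonneg hs.le ?_
  have hsum : ∑ j, z (q j) (a j) (b j) (x j) (y j)
      = Real.log (2 ^ (n * τ) * ∏ j, E.ref V k₁ k₂ (q j) (a j) (b j) (y j))
        - Real.log (powChannel V n a b x y) := by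
    rw [Real.log_mul (by positivity) hrpos.ne', Real.log_rpow two_pos,
      Real.log_prod (fun j _ => (hrj j).ne'), powChannel, Real.log_prod (fun j _ => (hVj j).ne')]
    have hzj (j : Fin n) : z (q j) (a j) (b j) (x j) (y j) = Real.log 2 * τ +
        Real.log (E.ref V k₁ k₂ (q j) (a j) (b j) (y j)) - Real.log (V (a j) (b j) (x j) (y j)) := by
      simp only [z, Real.logb]
      rw [Real.log_div (hVj j).ne' (hrj j).ne']
      field_simp
      ring
    simp only [hzj, Finset.sum_sub_distrib, Finset.sum_add_distrib, Finset.sum_const,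
      Finset.card_univ, Fintype.card_fin, nsmul_eq_mul]
    ring
  rw [hsum]
  exact sub_nonneg.2 (Real.log_le_log hpos hlt.le)

end Ensemble

/-! ### Message counts and achievability -/

theorem numMessages_pos (R : ℝ) (n : ℕ) : 0 < numMessages R n :=
  Nat.ceil_pos.2 (Real.rpow_pos_of_pos two_pos _)

theorem numMessages_zero (n : ℕ) : numMessages 0 n = 1 := by simp [numMessages]

theorem le_numMessages (R : ℝ) (n : ℕ) : (2 : ℝ) ^ (n * R) ≤ numMessages R n := Nat.le_ceil _

theorem numMessages_le {R : ℝ} (hR : 0 ≤ R) (n : ℕ) :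
    (numMessages R n : ℝ) ≤ 2 * 2 ^ (n * R) := by
  have h1 := (Nat.ceil_lt_add_one
    (Real.rpow_nonneg zero_le_two (n * R) : (0 : ℝ) ≤ 2 ^ (n * R))).le
  have h2 : (1 : ℝ) ≤ 2 ^ (n * R) := Real.one_le_rpow one_le_two (by positivity)
  unfold numMessages
  linarith

/-- The sum rate of the messages of the relay and of those sources whose flag is `false`. -/
def sumRate (R : ℝ × ℝ × ℝ) (k₁ k₂ : Bool) : ℝ :=
  (bif k₁ then 0 else R.1) + (bif k₂ then 0 else R.2.1) + R.2.2

theorem sum_pmf {α : Type*} [Fintype α] (p : PMF α) : ∑ a, p a = 1 := by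
  rw [← tsum_fintype (L := .unconditional α), p.tsum_coe]

theorem toReal_mem_stdSimplex {α : Type*} [Fintype α] (p : PMF α) :
    (fun a => (p a).toReal) ∈ stdSimplex ℝ α := by
  refine ⟨fun a => ENNReal.toReal_nonneg, ?_⟩
  rw [← ENNReal.toReal_sum fun a _ => p.apply_ne_top a, sum_pmf, ENNReal.toReal_one]

section

variable {𝒳₁ 𝒳₂ 𝒳₃ 𝒴 Q U₁ U₂ : Type*} [Fintype 𝒳₁] [Fintype 𝒳₂] [Fintype 𝒳₃] [Fintype 𝒴]
  [Fintype Q] [Fintype U₁] [Fintype U₂]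

/-- The channel with additional source inputs that do not influence the output. -/
def Channel.extend (W : Channel 𝒳₁ 𝒳₂ 𝒳₃ 𝒴) (U₁ U₂ : Type*) (a : 𝒳₁ × U₁) (b : 𝒳₂ × U₂) (x : 𝒳₃)
    (y : 𝒴) : ℝ :=
  (W a.1 b.1 x y).toReal

theorem Channel.extend_mem (W : Channel 𝒳₁ 𝒳₂ 𝒳₃ 𝒴) (a : 𝒳₁ × U₁) (b : 𝒳₂ × U₂) (x : 𝒳₃) :
    W.extend U₁ U₂ a b x ∈ stdSimplex ℝ 𝒴 :=
  toReal_mem_stdSimplex _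

theorem Code.errorProb_nonneg {M₁ M₂ M₃ n : ℕ} (c : Code 𝒳₁ 𝒳₂ 𝒳₃ 𝒴 M₁ M₂ M₃ n)
    (W : Channel 𝒳₁ 𝒳₂ 𝒳₃ 𝒴) : 0 ≤ c.errorProb W := by
  refine mul_nonneg (by positivity) (Finset.sum_nonneg fun w _ => Finset.sum_nonneg fun y _ => ?_)
  split_ifs
  · exact Finset.prod_nonneg fun _ _ => ENNReal.toReal_nonneg
  · exact le_rfl

/-- The number of message triplets that differ from `w` exactly in prescribed source messages
is exponential in their sum rate. -/
theorem card_pattern_le {R : ℝ × ℝ × ℝ} (h₁ : 0 ≤ R.1) (h₂ : 0 ≤ R.2.1) (h₃ : 0 ≤ R.2.2) (n : ℕ)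
    (w : Fin (numMessages R.1 n) × Fin (numMessages R.2.1 n) × Fin (numMessages R.2.2 n))
    (k₁ k₂ : Bool) :
    ((Finset.univ.filter fun w' => w ≠ w' ∧ decide (w.1 = w'.1) = k₁ ∧
      decide (w.2.1 = w'.2.1) = k₂).card : ℝ)
      ≤ if sumRate R k₁ k₂ = 0 then 0 else 8 * 2 ^ (n * sumRate R k₁ k₂) := by
  obtain ⟨R₁, R₂, R₃⟩ := R
  simp only at h₁ h₂ h₃ w ⊢
  split_ifs with h0
  · have hr₁ : 0 ≤ bif k₁ then 0 else R₁ := by cases k₁ <;> simp [h₁]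
    have hr₂ : 0 ≤ bif k₂ then 0 else R₂ := by cases k₂ <;> simp [h₂]
    -- Nonnegative rates with zero sum all vanish, so each unknown message has a single value and
    -- there is no competitor.
    have hz : (bif k₁ then 0 else R₁) = 0 ∧ (bif k₂ then 0 else R₂) = 0 ∧ R₃ = 0 := by
      simp only [sumRate] at h0
      refine ⟨?_, ?_, ?_⟩ <;> linarith
    obtain ⟨hz₁, hz₂, rfl⟩ := hz
    have sub {S : ℝ} (hS : S = 0) (u v : Fin (numMessages S n)) : u = v := by
      subst hS
      have : numMessages 0 n = 1 := numMessages_zero n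
      ext; omega
    refine (Nat.cast_eq_zero.2 (Finset.card_eq_zero.2 (Finset.filter_eq_empty_iff.2 ?_))).le
    rintro w' - ⟨hne, hk₁, hk₂⟩
    refine hne (Prod.ext ?_ (Prod.ext ?_ (sub rfl _ _)))
    · cases k₁
      · exact sub hz₁ _ _
      · simpa using hk₁
    · cases k₂
      · exact sub hz₂ _ _
      · simpa using hk₂
  -- Forgetting `w ≠ w'` and the inequality of unknown messages leaves a box; rounding costs at most
  -- a factor 2 per message set, hence 8.
  · let T₁ : Finset (Fin (numMessages R₁ n)) := bif k₁ then {w.1} else Finset.univ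
    let T₂ : Finset (Fin (numMessages R₂ n)) := bif k₂ then {w.2.1} else Finset.univ
    have hT₁ : (T₁.card : ℝ) ≤ 2 * 2 ^ (n * bif k₁ then 0 else R₁) := by
      cases k₁
      · simpa [T₁] using numMessages_le h₁ n
      · simp [T₁]
    have hT₂ : (T₂.card : ℝ) ≤ 2 * 2 ^ (n * bif k₂ then 0 else R₂) := by
      cases k₂
      · simpa [T₂] using numMessages_le h₂ n
      · simp [T₂]
    have hsub : (Finset.univ.filter fun w' => w ≠ w' ∧ decide (w.1 = w'.1) = k₁ ∧
        decide (w.2.1 = w'.2.1) = k₂) ⊆ T₁ ×ˢ T₂ ×ˢ Finset.univ := by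
      intro w' hw'
      simp only [Finset.mem_filter, Finset.mem_univ, true_and] at hw'
      obtain ⟨-, hk₁, hk₂⟩ := hw'
      simp only [Finset.mem_product, Finset.mem_univ, and_true]
      constructor
      · cases k₁
        · simp [T₁]
        · simpa [T₁, eq_comm] using hk₁
      · cases k₂
        · simp [T₂]
        · simpa [T₂, eq_comm] using hk₂
    calc _ ≤ ((T₁ ×ˢ T₂ ×ˢ (Finset.univ : Finset (Fin (numMessages R₃ n)))).card : ℝ) :=
          Nat.cast_le.2 (Finset.card_le_card hsub)
      _ = T₁.card * (T₂.card * numMessages R₃ n) := by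
          simp [Finset.card_product]
      _ ≤ (2 * 2 ^ (n * bif k₁ then 0 else R₁)) * ((2 * 2 ^ (n * bif k₂ then 0 else R₂)) *
            (2 * 2 ^ (n * R₃))) := by
          have := numMessages_le h₃ n
          gcongr
      _ = _ := by
          simp only [sumRate, mul_add, Real.rpow_add two_pos]
          ring

-- With τ strictly between sum rate and information, both error terms decay geometrically. A zero
-- sum rate needs no strict inequality, which keeps patterns with zero information usable.
open Classical in
theorem achievable_of_lt_info (W : Channel 𝒳₁ 𝒳₂ 𝒳₃ 𝒴)
    (E : Ensemble Q (𝒳₁ × U₁) (𝒳₂ × U₂) 𝒳₃) {R : ℝ × ℝ × ℝ}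
    (h₁ : 0 ≤ R.1) (h₂ : 0 ≤ R.2.1) (h₃ : 0 ≤ R.2.2)
    (hR : ∀ k₁ k₂, sumRate R k₁ k₂ = 0 ∨ sumRate R k₁ k₂ < E.info (W.extend U₁ U₂) k₁ k₂) :
    W.Achievable R := by
  have hV := W.extend_mem (U₁ := U₁) (U₂ := U₂)
  have hτ (k₁ k₂ : Bool) : ∃ τ < E.info (W.extend U₁ U₂) k₁ k₂,
      sumRate R k₁ k₂ = 0 ∨ sumRate R k₁ k₂ < τ := by
    rcases hR k₁ k₂ with h | h
    -- Without competitors any threshold below the information will do.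
    · exact ⟨_, sub_one_lt _, Or.inl h⟩
    · obtain ⟨τ, ha, hb⟩ := exists_between h
      exact ⟨τ, hb, Or.inr ha⟩
  choose τ hτI hτR using hτ
  choose c hc0 hc1 hc using fun k₁ k₂ => E.exists_pow_bound hV (hτI k₁ k₂)
  -- Per pattern: rejection of the true triplet, plus the number of competitors times the
  -- probability of accepting one.
  let B (n : ℕ) : ℝ := ∑ k₁, ∑ k₂, (c k₁ k₂ ^ n + (if sumRate R k₁ k₂ = 0 then 0 else
    8 * 2 ^ (n * sumRate R k₁ k₂)) * 2 ^ (-(n * τ k₁ k₂)))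
  have hB : Tendsto B atTop (𝓝 0) := by
    have : (0 : ℝ) = ∑ k₁ : Bool, ∑ k₂ : Bool, (0 + 0) := by simp
    rw [this]
    refine tendsto_finsetSum _ fun k₁ _ => tendsto_finsetSum _ fun k₂ _ => Tendsto.add ?_ ?_
    · exact tendsto_pow_atTop_nhds_zero_of_lt_one (hc0 _ _) (hc1 _ _)
    · split_ifs with h0
      · simp
      · have hlt := (hτR k₁ k₂).resolve_left h0
        have hd : Tendsto (fun n : ℕ => 8 * ((2 : ℝ) ^ (sumRate R k₁ k₂ - τ k₁ k₂)) ^ n) atTop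
            (𝓝 (8 * 0)) :=
          (tendsto_pow_atTop_nhds_zero_of_lt_one (by positivity)
            (Real.rpow_lt_one_of_one_lt_of_neg one_lt_two (by linarith))).const_mul _
        rw [mul_zero] at hd
        refine hd.congr fun n => ?_
        rw [mul_assoc, ← Real.rpow_add two_pos, ← Real.rpow_natCast, ← Real.rpow_mul zero_le_two]
        congr 2
        ring
  have hcode (n : ℕ) : ∃ C : Code 𝒳₁ 𝒳₂ 𝒳₃ 𝒴
      (numMessages R.1 n) (numMessages R.2.1 n) (numMessages R.2.2 n) n, C.errorProb W ≤ B n := by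
    have : Nonempty (Fin (numMessages R.1 n)) := ⟨⟨0, numMessages_pos _ _⟩⟩
    have : Nonempty (Fin (numMessages R.2.1 n)) := ⟨⟨0, numMessages_pos _ _⟩⟩
    have : Nonempty (Fin (numMessages R.2.2 n)) := ⟨⟨0, numMessages_pos _ _⟩⟩
    let S (q : Fin n → Q) (a : Fin n → 𝒳₁ × U₁) (b : Fin n → 𝒳₂ × U₂) (x : Fin n → 𝒳₃)
        (y : Fin n → 𝒴) : Prop :=
      ∀ k₁ k₂, 2 ^ (n * τ k₁ k₂) * (E.pow n).ref (powChannel (W.extend U₁ U₂) n) k₁ k₂ q a b y ≤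
        powChannel (W.extend U₁ U₂) n a b x y
    obtain ⟨fa, fb, fx, dec, h⟩ := (E.pow n).exists_code
      (I := Fin (numMessages R.1 n)) (J := Fin (numMessages R.2.1 n))
      (K := Fin (numMessages R.2.2 n)) (powChannel_mem hV n) S
      (fun k₁ k₂ => 2 ^ (-(n * τ k₁ k₂)))
      (fun k₁ k₂ q a b x y hs => by
        rw [Real.rpow_neg zero_le_two, ← div_eq_inv_mul, le_div_iff₀ (by positivity), mul_comm]
        exact hs k₁ k₂)
      (fun k₁ k₂ => by positivity)
    -- The channel ignores the auxiliary letters, so only the first components are sent.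
    refine ⟨⟨fun i j => (fa i j).1, fun i j => (fb i j).1, fx, dec⟩, ?_⟩
    have hM : (0 : ℝ) < (numMessages R.1 n : ℝ) * numMessages R.2.1 n * numMessages R.2.2 n := by
      have := numMessages_pos R.1 n
      have := numMessages_pos R.2.1 n
      have := numMessages_pos R.2.2 n
      positivity
    rw [Code.errorProb, one_div, ← div_eq_inv_mul, div_le_iff₀ hM]
    calc _ ≤ _ := le_trans (le_of_eq ?_) h
      _ ≤ ∑ w : Fin (numMessages R.1 n) × Fin (numMessages R.2.1 n) × Fin (numMessages R.2.2 n),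
            B n := ?_
      _ = _ := by simp; ring
    · refine Finset.sum_congr rfl fun w _ => Finset.sum_congr rfl fun y _ => ?_
      congr 1
    · refine Finset.sum_le_sum fun w _ => ?_
      simp only [B, Finset.sum_add_distrib]
      refine add_le_add ?_ ?_
      · calc _ ≤ (E.pow n).avg fun q a b x => ∑ k₁, ∑ k₂, ∑ y,
                powChannel (W.extend U₁ U₂) n a b x y *
                  if powChannel (W.extend U₁ U₂) n a b x y < 2 ^ (n * τ k₁ k₂) *
                    (E.pow n).ref (powChannel (W.extend U₁ U₂) n) k₁ k₂ q a b y then 1 else 0 := ?_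
          _ = ∑ k₁, ∑ k₂, (E.pow n).avg fun q a b x => ∑ y,
                powChannel (W.extend U₁ U₂) n a b x y *
                  if powChannel (W.extend U₁ U₂) n a b x y < 2 ^ (n * τ k₁ k₂) *
                    (E.pow n).ref (powChannel (W.extend U₁ U₂) n) k₁ k₂ q a b y then 1 else 0 := by
              rw [Ensemble.avg_sum]
              exact Finset.sum_congr rfl fun k₁ _ => Ensemble.avg_sum _ _ _
          _ ≤ _ := Finset.sum_le_sum fun k₁ _ => Finset.sum_le_sum fun k₂ _ => hc k₁ k₂ n
        refine Ensemble.avg_mono _ fun q a b x => ?_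
        have hnn (k₁ k₂ : Bool) (y : Fin n → 𝒴) :
            (0 : ℝ) ≤ if powChannel (W.extend U₁ U₂) n a b x y < 2 ^ (n * τ k₁ k₂) *
              (E.pow n).ref (powChannel (W.extend U₁ U₂) n) k₁ k₂ q a b y then 1 else 0 := by
          split_ifs <;> norm_num
        simp_rw [Finset.sum_comm (s := (Finset.univ : Finset Bool))
          (t := (Finset.univ : Finset (Fin n → 𝒴)))]
        refine Finset.sum_le_sum fun y _ => ?_
        simp only [← Finset.mul_sum]
        refine mul_le_mul_of_nonneg_left ?_ ((powChannel_mem hV n a b x).1 y)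
        split_ifs with hs
        · exact Finset.sum_nonneg fun k₁ _ => Finset.sum_nonneg fun k₂ _ => hnn k₁ k₂ y
        · simp only [S, not_forall, not_le] at hs
          obtain ⟨k₁, k₂, hk⟩ := hs
          refine le_trans ?_ (Finset.single_le_sum (fun k₁ _ => Finset.sum_nonneg
            fun k₂ _ => hnn k₁ k₂ y) (Finset.mem_univ k₁))
          refine le_trans ?_ (Finset.single_le_sum (fun k₂ _ => hnn k₁ k₂ y) (Finset.mem_univ k₂))
          rw [if_pos hk]
      -- Competitors are sorted by pattern, to be counted by `card_pattern_le`.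
      · have hsplit (w' : Fin (numMessages R.1 n) × Fin (numMessages R.2.1 n) ×
            Fin (numMessages R.2.2 n)) :
            (2 : ℝ) ^ (-(n * τ (decide (w.1 = w'.1)) (decide (w.2.1 = w'.2.1)))) =
              ∑ k₁, ∑ k₂, if decide (w.1 = w'.1) = k₁ ∧ decide (w.2.1 = w'.2.1) = k₂ then
                (2 : ℝ) ^ (-(n * τ k₁ k₂)) else 0 := by
          by_cases e₁ : w.1 = w'.1 <;> by_cases e₂ : w.2.1 = w'.2.1 <;> simp [e₁, e₂]
        simp_rw [hsplit]
        rw [Finset.sum_comm]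
        refine Finset.sum_le_sum fun k₁ _ => ?_
        rw [Finset.sum_comm]
        refine Finset.sum_le_sum fun k₂ _ => ?_
        rw [← Finset.sum_filter, Finset.filter_filter, Finset.sum_const, nsmul_eq_mul]
        refine mul_le_mul_of_nonneg_right ?_ (by positivity)
        exact card_pattern_le h₁ h₂ h₃ n w k₁ k₂
  choose C hC using hcode
  exact ⟨h₁, h₂, h₃, C, squeeze_zero (fun n => (C n).errorProb_nonneg W) hC hB⟩

end

/-! ### Mutual information as a mean log-likelihood ratio -/

section Information

variable {Ω α β γ : Type*} [Fintype Ω] (μ : PMF Ω)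

open Classical in
theorem prob_eq_sum (A : Ω → α) (a : α) :
    prob μ A a = ∑ ω, (μ ω).toReal * if A ω = a then 1 else 0 := by
  rw [prob, PMF.map_apply, tsum_fintype, ENNReal.toReal_sum]
  · refine Finset.sum_congr rfl fun ω _ => ?_
    by_cases h : A ω = a
    · simp [h]
    · simp [h, Ne.symm h]
  · intro ω _
    split_ifs
    · exact μ.apply_ne_top ω
    · exact ENNReal.zero_ne_top

theorem prob_self_pos (A : Ω → α) {ω : Ω} (hω : 0 < (μ ω).toReal) : 0 < prob μ A (A ω) := by
  classical
  rw [prob_eq_sum]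
  refine lt_of_lt_of_le ?_ (Finset.single_le_sum (fun ω' _ => ?_) (Finset.mem_univ ω))
  · simpa using hω
  · split_ifs <;> simp

theorem sum_prob_mul [Fintype α] (A : Ω → α) (g : α → ℝ) :
    ∑ a, prob μ A a * g a = ∑ ω, (μ ω).toReal * g (A ω) := by
  classical
  simp_rw [prob_eq_sum, Finset.sum_mul]
  rw [Finset.sum_comm]
  simp

/-- Here `v` plays p(b|a,c) and `r` plays p(b|c). Stating them through products avoids conditioning
on null events; on outcomes of positive mass the marginals cancel. -/
theorem condMutualInfo_eq_sum [Fintype α] [Fintype β] [Fintype γ] (A : Ω → α) (B : Ω → β)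
    (C : Ω → γ) (v r : Ω → ℝ)
    (hv : ∀ ω, prob μ (fun ω => (A ω, B ω, C ω)) (A ω, B ω, C ω)
      = prob μ (fun ω => (A ω, C ω)) (A ω, C ω) * v ω)
    (hr : ∀ ω, prob μ (fun ω => (B ω, C ω)) (B ω, C ω) = prob μ C (C ω) * r ω) :
    condMutualInfo μ A B C = ∑ ω, (μ ω).toReal * Real.logb 2 (v ω / r ω) := by
  have h := sum_prob_mul μ (fun ω => (A ω, B ω, C ω)) fun z => Real.logb 2
    ((prob μ (fun ω => (A ω, B ω, C ω)) z * prob μ C z.2.2) /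
          (prob μ (fun ω => (A ω, C ω)) (z.1, z.2.2) * prob μ (fun ω => (B ω, C ω)) z.2))
  simp only [Fintype.sum_prod_type] at h
  rw [condMutualInfo, h]
  refine Finset.sum_congr rfl fun ω _ => ?_
  rcases (ENNReal.toReal_nonneg (a := μ ω)).eq_or_lt with h0 | hpos
  · rw [← h0, zero_mul, zero_mul]
  · rw [hv, hr]
    have h1 := prob_self_pos μ (fun ω => (A ω, C ω)) hpos
    have h2 := prob_self_pos μ C hpos
    congr 2
    rw [mul_right_comm, ← mul_assoc, mul_div_mul_left _ _ (by positivity)]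

end Information

variable {𝒬 𝒰₁ 𝒳₁ 𝒰₂ 𝒳₂ 𝒳₃ 𝒴 : Type*} [Fintype 𝒬] [Fintype 𝒰₁] [Fintype 𝒳₁] [Fintype 𝒰₂]
  [Fintype 𝒳₂] [Fintype 𝒳₃] [Fintype 𝒴]

/-- The ensemble given by probability mass functions. -/
def Ensemble.ofPMF (pQ : PMF 𝒬) (p₁ : 𝒬 → PMF (𝒳₁ × 𝒰₁)) (p₂ : 𝒬 → PMF (𝒳₂ × 𝒰₂))
    (p₃ : 𝒰₁ → 𝒰₂ → 𝒬 → PMF 𝒳₃) : Ensemble 𝒬 (𝒳₁ × 𝒰₁) (𝒳₂ × 𝒰₂) 𝒳₃ where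
  pQ q := (pQ q).toReal
  pA q a := (p₁ q a).toReal
  pB q b := (p₂ q b).toReal
  pX q a b x := (p₃ a.2 b.2 q x).toReal
  pQ_mem := toReal_mem_stdSimplex _
  pA_mem _ := toReal_mem_stdSimplex _
  pB_mem _ := toReal_mem_stdSimplex _
  pX_mem _ _ _ := toReal_mem_stdSimplex _

section Factorization

variable {W : Channel 𝒳₁ 𝒳₂ 𝒳₃ 𝒴} {μ : PMF (Outcome 𝒬 𝒰₁ 𝒳₁ 𝒰₂ 𝒳₂ 𝒳₃ 𝒴)}
  {E : Ensemble 𝒬 (𝒳₁ × 𝒰₁) (𝒳₂ × 𝒰₂) 𝒳₃}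

/-- The joint law `μ` is that of an ensemble and the output of the channel `W`. -/
def Ensemble.Induces (E : Ensemble 𝒬 (𝒳₁ × 𝒰₁) (𝒳₂ × 𝒰₂) 𝒳₃) (W : Channel 𝒳₁ 𝒳₂ 𝒳₃ 𝒴)
    (μ : PMF (Outcome 𝒬 𝒰₁ 𝒳₁ 𝒰₂ 𝒳₂ 𝒳₃ 𝒴)) : Prop :=
  ∀ q a b x y, (μ (q, a.2, a.1, b.2, b.1, x, y)).toReal
    = E.joint (q, a, b, x) * W.extend 𝒰₁ 𝒰₂ a b x y

theorem Ensemble.Induces.sum_mul (h : E.Induces W μ)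
    (f : Outcome 𝒬 𝒰₁ 𝒳₁ 𝒰₂ 𝒳₂ 𝒳₃ 𝒴 → ℝ) :
    ∑ ω, (μ ω).toReal * f ω = E.avg fun q a b x =>
      ∑ y, W.extend 𝒰₁ 𝒰₂ a b x y * f (q, a.2, a.1, b.2, b.1, x, y) := by
  rw [E.avg_eq_sum]
  simp only [Fintype.sum_prod_type, Finset.mul_sum]
  refine Finset.sum_congr rfl fun q _ => ?_
  rw [Finset.sum_comm]
  refine Finset.sum_congr rfl fun x₁ _ => Finset.sum_congr rfl fun u₁ _ => ?_
  rw [Finset.sum_comm]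
  refine Finset.sum_congr rfl fun x₂ _ => Finset.sum_congr rfl fun u₂ _ =>
    Finset.sum_congr rfl fun x _ => Finset.sum_congr rfl fun y _ => ?_
  rw [← mul_assoc, ← h q (x₁, u₁) (x₂, u₂) x y]

-- By `hFG`, A and C determine all three channel inputs, so the law of Y given both is the channel
-- itself. By `hG`, the law of Y given C is `ref`.
open Classical in
theorem Ensemble.Induces.condMutualInfo_eq {α γ : Type*} [Fintype α] [Fintype γ]
    (h : E.Induces W μ) (k₁ k₂ : Bool)
    (A : Outcome 𝒬 𝒰₁ 𝒳₁ 𝒰₂ 𝒳₂ 𝒳₃ 𝒴 → α) (C : Outcome 𝒬 𝒰₁ 𝒳₁ 𝒰₂ 𝒳₂ 𝒳₃ 𝒴 → γ)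
    (F : 𝒬 → (𝒳₁ × 𝒰₁) → (𝒳₂ × 𝒰₂) → 𝒳₃ → α) (G : 𝒬 → (𝒳₁ × 𝒰₁) → (𝒳₂ × 𝒰₂) → γ)
    (hA : ∀ q a b x y, A (q, a.2, a.1, b.2, b.1, x, y) = F q a b x)
    (hC : ∀ q a b x y, C (q, a.2, a.1, b.2, b.1, x, y) = G q a b)
    (hFG : ∀ q a b x q' a' b' x', F q a b x = F q' a' b' x' → G q a b = G q' a' b' →
      a.1 = a'.1 ∧ b.1 = b'.1 ∧ x = x')
    (hG : ∀ q a b y, ∑ q', E.pQ q' * ∑ a', E.pA q' a' * ∑ b', E.pB q' b' *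
        (E.out (W.extend 𝒰₁ 𝒰₂) q' a' b' y * if G q' a' b' = G q a b then 1 else 0)
      = (∑ q', E.pQ q' * ∑ a', E.pA q' a' * ∑ b', E.pB q' b' *
        if G q' a' b' = G q a b then 1 else 0) * E.ref (W.extend 𝒰₁ 𝒰₂) k₁ k₂ q a b y) :
    condMutualInfo μ A Outcome.y C = E.info (W.extend 𝒰₁ 𝒰₂) k₁ k₂ := by
  rw [condMutualInfo_eq_sum μ A Outcome.y C
    (fun ω => W.extend 𝒰₁ 𝒰₂ (ω.x₁, ω.u₁) (ω.x₂, ω.u₂) ω.x₃ ω.y)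
    (fun ω => E.ref (W.extend 𝒰₁ 𝒰₂) k₁ k₂ ω.q (ω.x₁, ω.u₁) (ω.x₂, ω.u₂) ω.y), h.sum_mul]
  · rfl
  · rintro ⟨q, u₁, x₁, u₂, x₂, x, y⟩
    simp only [prob_eq_sum, h.sum_mul, Prod.mk.injEq, hA, hC]
    rw [mul_comm, ← E.avg_const_mul]
    congr 1
    funext q' a' b' x'
    rw [← Finset.sum_mul, (W.extend_mem a' b' x').2, one_mul]
    have e₁ : A (q, u₁, x₁, u₂, x₂, x, y) = F q (x₁, u₁) (x₂, u₂) x :=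
      hA q (x₁, u₁) (x₂, u₂) x y
    have e₂ : C (q, u₁, x₁, u₂, x₂, x, y) = G q (x₁, u₁) (x₂, u₂) :=
      hC q (x₁, u₁) (x₂, u₂) x y
    rw [e₁, e₂]
    by_cases h1 : F q' a' b' x' = F q (x₁, u₁) (x₂, u₂) x ∧ G q' a' b' = G q (x₁, u₁) (x₂, u₂)
    · obtain ⟨i₁, i₂, rfl⟩ := hFG _ _ _ _ _ _ _ _ h1.1 h1.2
      simp [h1.1, h1.2, Channel.extend, i₁, i₂]
    · have h2 (y' : 𝒴) : ¬ (F q' a' b' x' = F q (x₁, u₁) (x₂, u₂) x ∧ y' = y ∧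
          G q' a' b' = G q (x₁, u₁) (x₂, u₂)) := fun h => h1 ⟨h.1, h.2.2⟩
      simp [h1, h2]
  · rintro ⟨q, u₁, x₁, u₂, x₂, x, y⟩
    simp only [prob_eq_sum, h.sum_mul, Prod.mk.injEq, hC]
    have e₂ : C (q, u₁, x₁, u₂, x₂, x, y) = G q (x₁, u₁) (x₂, u₂) :=
      hC q (x₁, u₁) (x₂, u₂) x y
    rw [e₂]
    have hG' := hG q (x₁, u₁) (x₂, u₂) y
    have l (q' : 𝒬) (a' : 𝒳₁ × 𝒰₁) (b' : 𝒳₂ × 𝒰₂) :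
        ∑ x', E.pX q' a' b' x' * ∑ y', W.extend 𝒰₁ 𝒰₂ a' b' x' y' *
          (if y' = y ∧ G q' a' b' = G q (x₁, u₁) (x₂, u₂) then 1 else 0)
        = E.out (W.extend 𝒰₁ 𝒰₂) q' a' b' y *
          if G q' a' b' = G q (x₁, u₁) (x₂, u₂) then 1 else 0 := by
      rw [Ensemble.out, Finset.sum_mul]
      refine Finset.sum_congr rfl fun x' _ => ?_
      rw [mul_assoc]
      congr 1
      split_ifs with hg <;> simp [hg]
    have r (q' : 𝒬) (a' : 𝒳₁ × 𝒰₁) (b' : 𝒳₂ × 𝒰₂) :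
        ∑ x', E.pX q' a' b' x' * ∑ y', W.extend 𝒰₁ 𝒰₂ a' b' x' y' *
          (if G q' a' b' = G q (x₁, u₁) (x₂, u₂) then 1 else 0)
        = if G q' a' b' = G q (x₁, u₁) (x₂, u₂) then 1 else 0 := by
      simp only [sum_mul_const_of_mem (W.extend_mem _ _ _),
        sum_mul_const_of_mem (E.pX_mem _ _ _)]
    simp only [Ensemble.avg, l, r]
    exact hG'

/-- The four conditionings are the four flag patterns, which lets both directions treat the bounds
uniformly. -/
theorem Ensemble.Induces.rateBounds_iff (h : E.Induces W μ) (R : ℝ × ℝ × ℝ) :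
    RateBounds μ R.1 R.2.1 R.2.2 ↔
      ∀ k₁ k₂, sumRate R k₁ k₂ ≤ E.info (W.extend 𝒰₁ 𝒰₂) k₁ k₂ := by
  classical
  have h11 : condMutualInfo μ Outcome.x₃ Outcome.y
      (fun ω => (ω.x₁, ω.x₂, ω.u₁, ω.u₂, ω.q)) = E.info (W.extend 𝒰₁ 𝒰₂) true true := by
    refine h.condMutualInfo_eq true true _ _ (fun _ _ _ x => x)
      (fun q a b => (a.1, b.1, a.2, b.2, q)) (fun _ _ _ _ _ => rfl) (fun _ _ _ _ _ => rfl)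
      (fun q a b x q' a' b' x' hF hG => ?_) fun q a b y => ?_
    · simp only [Prod.mk.injEq] at hG
      exact ⟨hG.1, hG.2.1, hF⟩
    · have e (q' : 𝒬) (a' : 𝒳₁ × 𝒰₁) (b' : 𝒳₂ × 𝒰₂) :
          ((a'.1, b'.1, a'.2, b'.2, q') = (a.1, b.1, a.2, b.2, q)) ↔
            q' = q ∧ a' = a ∧ b' = b := by
        simp only [Prod.ext_iff]; tauto
      simp only [e, ite_and]
      simp [Ensemble.ref, mul_assoc]
  have h01 : condMutualInfo μ (fun ω => (ω.x₁, ω.x₃)) Outcome.y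
      (fun ω => (ω.x₂, ω.u₂, ω.q)) = E.info (W.extend 𝒰₁ 𝒰₂) false true := by
    refine h.condMutualInfo_eq false true _ _ (fun _ a _ x => (a.1, x))
      (fun q _ b => (b.1, b.2, q)) (fun _ _ _ _ _ => rfl) (fun _ _ _ _ _ => rfl)
      (fun q a b x q' a' b' x' hF hG => ?_) fun q a b y => ?_
    · simp only [Prod.mk.injEq] at hF hG
      exact ⟨hF.1, hG.1, hF.2⟩
    · have e (q' : 𝒬) (b' : 𝒳₂ × 𝒰₂) :
          ((b'.1, b'.2, q') = (b.1, b.2, q)) ↔ q' = q ∧ b' = b := by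
        simp only [Prod.ext_iff]; tauto
      simp only [e, ite_and]
      simp [Ensemble.ref, mul_assoc, ← Finset.sum_mul, (E.pA_mem q).2, Finset.mul_sum]
      exact Finset.sum_congr rfl fun _ _ => by ring
  have h10 : condMutualInfo μ (fun ω => (ω.x₂, ω.x₃)) Outcome.y
      (fun ω => (ω.x₁, ω.u₁, ω.q)) = E.info (W.extend 𝒰₁ 𝒰₂) true false := by
    refine h.condMutualInfo_eq true false _ _ (fun _ _ b x => (b.1, x))
      (fun q a _ => (a.1, a.2, q)) (fun _ _ _ _ _ => rfl) (fun _ _ _ _ _ => rfl)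
      (fun q a b x q' a' b' x' hF hG => ?_) fun q a b y => ?_
    · simp only [Prod.mk.injEq] at hF hG
      exact ⟨hG.1, hF.1, hF.2⟩
    · have e (q' : 𝒬) (a' : 𝒳₁ × 𝒰₁) :
          ((a'.1, a'.2, q') = (a.1, a.2, q)) ↔ q' = q ∧ a' = a := by
        simp only [Prod.ext_iff]; tauto
      simp only [e, ite_and]
      simp [Ensemble.ref, mul_assoc, (E.pB_mem q).2]
  have h00 : condMutualInfo μ (fun ω => (ω.x₁, ω.x₂, ω.x₃)) Outcome.y
      Outcome.q = E.info (W.extend 𝒰₁ 𝒰₂) false false := by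
    refine h.condMutualInfo_eq false false _ _ (fun _ a b x => (a.1, b.1, x))
      (fun q _ _ => q) (fun _ _ _ _ _ => rfl) (fun _ _ _ _ _ => rfl)
      (fun q a b x q' a' b' x' hF _ => ?_) fun q a b y => ?_
    · simp only [Prod.mk.injEq] at hF
      exact hF
    · simp [Ensemble.ref, ← Finset.sum_mul, (E.pB_mem q).2, (E.pA_mem q).2]
  rw [RateBounds, h11, h01, h10, h00]
  simp only [Bool.forall_bool, sumRate, cond_true, cond_false, zero_add, add_zero]
  tauto

theorem induces_ofPMF {pQ : PMF 𝒬} {p₁ : 𝒬 → PMF (𝒳₁ × 𝒰₁)} {p₂ : 𝒬 → PMF (𝒳₂ × 𝒰₂)}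
    {p₃ : 𝒰₁ → 𝒰₂ → 𝒬 → PMF 𝒳₃}
    (h : ∀ q u₁ x₁ u₂ x₂ x₃ y, μ (q, u₁, x₁, u₂, x₂, x₃, y) =
      pQ q * p₁ q (x₁, u₁) * p₂ q (x₂, u₂) * p₃ u₁ u₂ q x₃ * W x₁ x₂ x₃ y) :
    (Ensemble.ofPMF pQ p₁ p₂ p₃).Induces W μ := by
  intro q a b x y
  simp [h, Ensemble.joint, Ensemble.ofPMF, Channel.extend]

/-- Every choice of the conditional laws is that of some joint law. -/
theorem exists_joint (W : Channel 𝒳₁ 𝒳₂ 𝒳₃ 𝒴) (pQ : PMF 𝒬) (p₁ : 𝒬 → PMF (𝒳₁ × 𝒰₁))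
    (p₂ : 𝒬 → PMF (𝒳₂ × 𝒰₂)) (p₃ : 𝒰₁ → 𝒰₂ → 𝒬 → PMF 𝒳₃) :
    ∃ μ : PMF (Outcome 𝒬 𝒰₁ 𝒳₁ 𝒰₂ 𝒳₂ 𝒳₃ 𝒴), ∀ q u₁ x₁ u₂ x₂ x₃ y,
      μ (q, u₁, x₁, u₂, x₂, x₃, y) =
        pQ q * p₁ q (x₁, u₁) * p₂ q (x₂, u₂) * p₃ u₁ u₂ q x₃ * W x₁ x₂ x₃ y := by
  refine ⟨PMF.ofFintype (fun ω => pQ ω.q * p₁ ω.q (ω.x₁, ω.u₁) * p₂ ω.q (ω.x₂, ω.u₂) *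
    p₃ ω.u₁ ω.u₂ ω.q ω.x₃ * W ω.x₁ ω.x₂ ω.x₃ ω.y) ?_, fun q u₁ x₁ u₂ x₂ x₃ y => rfl⟩
  have h₁ (q : 𝒬) : ∑ u₁, ∑ x₁, p₁ q (x₁, u₁) = 1 := by
    rw [← Fintype.sum_prod_type_right (f := p₁ q), sum_pmf]
  have h₂ (q : 𝒬) : ∑ u₂, ∑ x₂, p₂ q (x₂, u₂) = 1 := by
    rw [← Fintype.sum_prod_type_right (f := p₂ q), sum_pmf]
  simp only [Fintype.sum_prod_type, Outcome.q, Outcome.u₁, Outcome.x₁, Outcome.u₂, Outcome.x₂,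
    Outcome.x₃, Outcome.y, ← Finset.mul_sum, sum_pmf, mul_one, h₁, h₂]

end Factorization

/-! ### Converse: change of measure and Fano's inequality -/

/-- A lower bound of a sum of relative entropies, from the inequality `log t ≥ 1 - 1 / t`
for the product laws. -/
theorem le_sum_mul_logb {𝒴 : Type*} [Fintype 𝒴] {n : ℕ} {v r : Fin n → 𝒴 → ℝ}
    (hv : ∀ j, v j ∈ stdSimplex ℝ 𝒴) (hvr : ∀ j y, 0 < v j y → 0 < r j y)
    (hr : ∀ j, r j ∈ stdSimplex ℝ 𝒴) {c : (Fin n → 𝒴) → ℝ} (hc : ∀ y, 0 < c y) :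
    (∑ y : Fin n → 𝒴, (∏ j, v j (y j)) * Real.logb 2 (c y)) +
        (1 - ∑ y : Fin n → 𝒴, (∏ j, r j (y j)) * c y) / Real.log 2
      ≤ ∑ j, ∑ y, v j y * Real.logb 2 (v j y / r j y) := by
  have hlog2 : 0 < Real.log 2 := Real.log_pos one_lt_two
  have h1 : ∑ j, ∑ y, v j y * Real.logb 2 (v j y / r j y)
      = ∑ y : Fin n → 𝒴, (∏ j, v j (y j)) * ∑ j, Real.logb 2 (v j (y j) / r j (y j)) := by
    simp only [Finset.mul_sum]
    conv_rhs => rw [Finset.sum_comm]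
    exact Finset.sum_congr rfl fun j _ =>
      (sum_prod_pi_mul hv j fun y => Real.logb 2 (v j y / r j y)).symm
  have hv1 : ∑ y : Fin n → 𝒴, ∏ j, v j (y j) = 1 := (prod_mem_stdSimplex hv).2
  rw [h1, ← hv1, ← Finset.sum_sub_distrib, Finset.sum_div,
    ← Finset.sum_add_distrib]
  refine Finset.sum_le_sum fun y _ => ?_
  have hrn : 0 ≤ ∏ j, r j (y j) := Finset.prod_nonneg fun j _ => (hr j).1 _
  have hvn : 0 ≤ ∏ j, v j (y j) := Finset.prod_nonneg fun j _ => (hv j).1 _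
  rcases hvn.eq_or_lt with h0 | hpos
  · rw [← h0, zero_mul, zero_mul, zero_add, zero_sub]
    exact div_nonpos_of_nonpos_of_nonneg (neg_nonpos.2 (mul_nonneg hrn (hc y).le)) hlog2.le
  have hvj (j : Fin n) : 0 < v j (y j) :=
    ((hv _).1 _).lt_of_ne fun h => hpos.ne' (Finset.prod_eq_zero (Finset.mem_univ j) h.symm)
  have hrj (j : Fin n) : 0 < r j (y j) := hvr j _ (hvj j)
  have hrpos : 0 < ∏ j, r j (y j) := Finset.prod_pos fun j _ => hrj j
  set p := ∏ j, v j (y j) with hp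
  set s := ∏ j, r j (y j) with hs
  have hsum : ∑ j, Real.logb 2 (v j (y j) / r j (y j))
      = (Real.log p - Real.log s) / Real.log 2 := by
    rw [hp, hs, Real.log_prod (fun j _ => (hrj j).ne'), Real.log_prod (fun j _ => (hvj j).ne'),
      ← Finset.sum_sub_distrib, Finset.sum_div]
    exact Finset.sum_congr rfl fun j _ => by
      rw [Real.logb, Real.log_div (hvj j).ne' (hrj j).ne']
  -- With t = s c / p, log t ≤ t - 1 reads log (p / s) ≥ log c + 1 - s c / p.
  have hlog := Real.log_le_sub_one_of_pos (x := s * c y / p)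
    (div_pos (mul_pos hrpos (hc y)) hpos)
  rw [Real.log_div (mul_pos hrpos (hc y)).ne' hpos.ne', Real.log_mul hrpos.ne' (hc y).ne'] at hlog
  have hlog' := mul_le_mul_of_nonneg_left hlog hpos.le
  have h2 : p * (s * c y / p - 1) = s * c y - p := by field_simp
  rw [hsum, Real.logb, mul_div_assoc', mul_div_assoc', ← add_div]
  refine div_le_div_of_nonneg_right ?_ hlog2.le
  linarith

/-- Each output is decoded to one `w` only, so it contributes a single ρ, at most the sum of all ρ;
each of these has mass one. -/
theorem sum_ite_eq_le_card {Ω K 𝒴 : Type*} [Fintype Ω] [DecidableEq Ω] [Fintype K] [Fintype 𝒴]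
    (dec : 𝒴 → Ω) (κ : Ω → K) {ρ : K → 𝒴 → ℝ} (hρ : ∀ k, ρ k ∈ stdSimplex ℝ 𝒴) :
    ∑ w, ∑ y, (if dec y = w then ρ (κ w) y else 0) ≤ Fintype.card K := by
  rw [Finset.sum_comm]
  calc ∑ y, ∑ w, (if dec y = w then ρ (κ w) y else 0) = ∑ y, ρ (κ (dec y)) y := by simp
    _ ≤ ∑ y, ∑ k, ρ k y := Finset.sum_le_sum fun y _ =>
        Finset.single_le_sum (f := fun k => ρ k y) (fun k _ => (hρ k).1 y) (Finset.mem_univ _)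
    _ = Fintype.card K := by
        rw [Finset.sum_comm]
        simp [(hρ _).2]

/-- The absolute continuity required by `le_sum_mul_logb`. -/
theorem Ensemble.ref_pos {Q A B X Y : Type*} [Fintype Q] [Fintype A] [Fintype B] [Fintype X]
    [Fintype Y] (E : Ensemble Q A B X) {V : A → B → X → Y → ℝ}
    (hV : ∀ a b x, V a b x ∈ stdSimplex ℝ Y) (k₁ k₂ : Bool) {q : Q} {a : A} {b : B} {x : X} {y : Y}
    (ha : 0 < E.pA q a) (hb : 0 < E.pB q b) (hx : 0 < E.pX q a b x) (hy : 0 < V a b x y) :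
    0 < E.ref V k₁ k₂ q a b y := by
  have hA := fun a => (E.pA_mem q).1 a
  have hB := fun b => (E.pB_mem q).1 b
  have ho := fun a b y => (E.out_mem hV q a b).1 y
  have h1 : 0 < E.out V q a b y := Finset.sum_pos' (fun x _ => mul_nonneg ((E.pX_mem q a b).1 x)
    ((hV a b x).1 y)) ⟨x, Finset.mem_univ x, mul_pos hx hy⟩
  cases k₁ <;> cases k₂
  · exact Finset.sum_pos' (fun a _ => mul_nonneg (hA a) (Finset.sum_nonneg
      fun b _ => mul_nonneg (hB b) (ho a b y))) ⟨a, Finset.mem_univ a, mul_pos ha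
      (Finset.sum_pos' (fun b _ => mul_nonneg (hB b) (ho a b y))
        ⟨b, Finset.mem_univ b, mul_pos hb h1⟩)⟩
  · exact Finset.sum_pos' (fun a _ => mul_nonneg (hA a) (ho a b y))
      ⟨a, Finset.mem_univ a, mul_pos ha h1⟩
  · exact Finset.sum_pos' (fun b _ => mul_nonneg (hB b) (ho a b y))
      ⟨b, Finset.mem_univ b, mul_pos hb h1⟩
  · exact h1

theorem toReal_map_pos {α β : Type*} (p : PMF α) (f : α → β) {a : α} (ha : p a ≠ 0) :
    0 < (p.map f (f a)).toReal := by
  refine ENNReal.toReal_pos ?_ (PMF.apply_ne_top _ _)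
  rw [← PMF.mem_support_iff, PMF.mem_support_map_iff]
  exact ⟨a, ha, rfl⟩

theorem toReal_uniformOfFintype {α : Type*} [Fintype α] [Nonempty α] (a : α) :
    (PMF.uniformOfFintype α a).toReal = (Fintype.card α : ℝ)⁻¹ := by
  simp [PMF.uniformOfFintype_apply]

section

variable {𝒳₁ 𝒳₂ 𝒳₃ 𝒴 : Type*} [Fintype 𝒳₁] [Fintype 𝒳₂] [Fintype 𝒳₃] [Fintype 𝒴]
  {M₁ M₂ M₃ n : ℕ} [NeZero M₁] [NeZero M₂] [NeZero M₃] [NeZero n]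

namespace Code

variable (C : Code 𝒳₁ 𝒳₂ 𝒳₃ 𝒴 M₁ M₂ M₃ n)

/-- The law of a source message and the letter sent by the first source at time `q`. -/
def law₁ (q : Fin n) : PMF (𝒳₁ × Fin M₁) :=
  (PMF.uniformOfFintype (Fin M₁)).map fun i => (C.enc₁ i q, i)

/-- The law of a source message and the letter sent by the second source at time `q`. -/
def law₂ (q : Fin n) : PMF (𝒳₂ × Fin M₂) :=
  (PMF.uniformOfFintype (Fin M₂)).map fun j => (C.enc₂ j q, j)

/-- The law of the letter sent by the relay at time `q`, given the source messages. -/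
def law₃ (i : Fin M₁) (j : Fin M₂) (q : Fin n) : PMF 𝒳₃ :=
  (PMF.uniformOfFintype (Fin M₃)).map fun k => C.enc₃ (i, j, k) q

/-- The ensemble of the letters sent by a code at a uniformly distributed time, the auxiliary
variables being the source messages. -/
def ensemble : Ensemble (Fin n) (𝒳₁ × Fin M₁) (𝒳₂ × Fin M₂) 𝒳₃ :=
  Ensemble.ofPMF (PMF.uniformOfFintype (Fin n)) C.law₁ C.law₂ C.law₃

theorem avg_ensemble (g : Fin n → 𝒳₁ × Fin M₁ → 𝒳₂ × Fin M₂ → 𝒳₃ → ℝ) :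
    C.ensemble.avg g = (n : ℝ)⁻¹ * ((M₁ * M₂ * M₃ : ℝ)⁻¹ * ∑ w : Fin M₁ × Fin M₂ × Fin M₃, ∑ q,
      g q (C.enc₁ w.1 q, w.1) (C.enc₂ w.2.1 q, w.2.1) (C.enc₃ w q)) := by
  have h₁ (q : Fin n) (f : 𝒳₁ × Fin M₁ → ℝ) : ∑ a, (C.law₁ q a).toReal * f a
      = (M₁ : ℝ)⁻¹ * ∑ i, f (C.enc₁ i q, i) := by
    rw [Finset.mul_sum]
    refine (sum_prob_mul (PMF.uniformOfFintype (Fin M₁)) (fun i => (C.enc₁ i q, i)) f).trans ?_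
    simp
  have h₂ (q : Fin n) (f : 𝒳₂ × Fin M₂ → ℝ) : ∑ b, (C.law₂ q b).toReal * f b
      = (M₂ : ℝ)⁻¹ * ∑ j, f (C.enc₂ j q, j) := by
    rw [Finset.mul_sum]
    refine (sum_prob_mul (PMF.uniformOfFintype (Fin M₂)) (fun j => (C.enc₂ j q, j)) f).trans ?_
    simp
  have h₃ (i : Fin M₁) (j : Fin M₂) (q : Fin n) (f : 𝒳₃ → ℝ) :
      ∑ x, (C.law₃ i j q x).toReal * f x = (M₃ : ℝ)⁻¹ * ∑ k, f (C.enc₃ (i, j, k) q) := by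
    rw [Finset.mul_sum]
    refine (sum_prob_mul (PMF.uniformOfFintype (Fin M₃)) (fun k => C.enc₃ (i, j, k) q) f).trans ?_
    simp
  simp only [Ensemble.avg, ensemble, Ensemble.ofPMF, h₁, h₂, h₃, toReal_uniformOfFintype,
    Fintype.card_fin]
  conv_rhs => rw [Finset.sum_comm]
  simp only [Fintype.sum_prod_type, Finset.mul_sum, mul_inv]
  refine Finset.sum_congr rfl fun q _ => Finset.sum_congr rfl fun i _ =>
    Finset.sum_congr rfl fun j _ => Finset.sum_congr rfl fun k _ => by ring

theorem ref_ensemble_pos (W : Channel 𝒳₁ 𝒳₂ 𝒳₃ 𝒴) (k₁ k₂ : Bool)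
    (w : Fin M₁ × Fin M₂ × Fin M₃) (q : Fin n) {y : 𝒴}
    (hy : 0 < (W (C.enc₁ w.1 q) (C.enc₂ w.2.1 q) (C.enc₃ w q) y).toReal) :
    0 < C.ensemble.ref (W.extend (Fin M₁) (Fin M₂)) k₁ k₂ q (C.enc₁ w.1 q, w.1)
      (C.enc₂ w.2.1 q, w.2.1) y := by
  refine C.ensemble.ref_pos W.extend_mem k₁ k₂ (x := C.enc₃ w q) ?_ ?_ ?_ hy
  · exact toReal_map_pos _ (fun i => (C.enc₁ i q, i)) (by simp)
  · exact toReal_map_pos _ (fun j => (C.enc₂ j q, j)) (by simp)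
  · exact toReal_map_pos _ (fun k => C.enc₃ (w.1, w.2.1, k) q) (by simp)

/-- The output law of a block given those of the source messages whose flag is `true`, with
output letters made independent. -/
def blockRef (W : Channel 𝒳₁ 𝒳₂ 𝒳₃ 𝒴) (k₁ k₂ : Bool) (i : Fin M₁) (j : Fin M₂)
    (y : Fin n → 𝒴) : ℝ :=
  ∏ q, C.ensemble.ref (W.extend (Fin M₁) (Fin M₂)) k₁ k₂ q (C.enc₁ i q, i) (C.enc₂ j q, j) (y q)

theorem blockRef_mem (W : Channel 𝒳₁ 𝒳₂ 𝒳₃ 𝒴) (k₁ k₂ : Bool) (i : Fin M₁) (j : Fin M₂) :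
    C.blockRef W k₁ k₂ i j ∈ stdSimplex ℝ (Fin n → 𝒴) :=
  prod_mem_stdSimplex fun q => C.ensemble.ref_mem W.extend_mem k₁ k₂ q _ _

/-- Averaged over messages, the letter divergences sum to n times `info`. The weight `c` is left
free: it will reward correct decoding. -/
theorem le_info (W : Channel 𝒳₁ 𝒳₂ 𝒳₃ 𝒴) (k₁ k₂ : Bool)
    {c : Fin M₁ × Fin M₂ × Fin M₃ → (Fin n → 𝒴) → ℝ} (hc : ∀ w y, 0 < c w y) :
    (M₁ * M₂ * M₃ : ℝ)⁻¹ * ∑ w : Fin M₁ × Fin M₂ × Fin M₃,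
        ((∑ y, W.blockProb (C.enc₁ w.1) (C.enc₂ w.2.1) (C.enc₃ w) y * Real.logb 2 (c w y)) +
          (1 - ∑ y, C.blockRef W k₁ k₂ w.1 w.2.1 y * c w y) / Real.log 2)
      ≤ n * C.ensemble.info (W.extend (Fin M₁) (Fin M₂)) k₁ k₂ := by
  have hn : (n : ℝ) ≠ 0 := Nat.cast_ne_zero.2 (NeZero.ne n)
  rw [Ensemble.info, avg_ensemble, mul_inv_cancel_left₀ hn]
  refine mul_le_mul_of_nonneg_left (Finset.sum_le_sum fun w _ => ?_) (by positivity)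
  exact le_sum_mul_logb (fun q => toReal_mem_stdSimplex _)
    (fun q y hy => C.ref_ensemble_pos W k₁ k₂ w q hy)
    (fun q => C.ensemble.ref_mem W.extend_mem k₁ k₂ q _ _) (hc w)

/-- The trivial weight 1 suffices. This settles patterns of zero sum rate in the converse. -/
theorem info_ensemble_nonneg (W : Channel 𝒳₁ 𝒳₂ 𝒳₃ 𝒴) (k₁ k₂ : Bool) :
    0 ≤ C.ensemble.info (W.extend (Fin M₁) (Fin M₂)) k₁ k₂ := by
  have hn : (0 : ℝ) < n := Nat.cast_pos.2 (Nat.pos_of_ne_zero (NeZero.ne n))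
  have h := C.le_info W k₁ k₂ (c := fun _ _ => 1) fun _ _ => one_pos
  simp only [Real.logb_one, mul_zero, Finset.sum_const_zero, mul_one,
    (C.blockRef_mem W k₁ k₂ _ _).2, sub_self, zero_div, add_zero] at h
  exact nonneg_of_mul_nonneg_right h hn

/-- The number of choices of the messages of the relay and of those sources whose flag is
`false`. -/
def numUnknown (M₁ M₂ M₃ : ℕ) (k₁ k₂ : Bool) : ℝ :=
  (bif k₁ then 1 else (M₁ : ℝ)) * (bif k₂ then 1 else (M₂ : ℝ)) * M₃

/-- The reference law depends on the known messages only, so under it the unknown ones can merely be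
guessed. -/
theorem sum_blockRef_le (W : Channel 𝒳₁ 𝒳₂ 𝒳₃ 𝒴) (k₁ k₂ : Bool) :
    (M₁ * M₂ * M₃ : ℝ)⁻¹ * ∑ w : Fin M₁ × Fin M₂ × Fin M₃,
      ∑ y, (if C.dec y = w then C.blockRef W k₁ k₂ w.1 w.2.1 y else 0) ≤
        (numUnknown M₁ M₂ M₃ k₁ k₂)⁻¹ := by
  have hM₁ : (0 : ℝ) < M₁ := Nat.cast_pos.2 (Nat.pos_of_ne_zero (NeZero.ne M₁))
  have hM₂ : (0 : ℝ) < M₂ := Nat.cast_pos.2 (Nat.pos_of_ne_zero (NeZero.ne M₂))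
  have hM₃ : (0 : ℝ) < M₃ := Nat.cast_pos.2 (Nat.pos_of_ne_zero (NeZero.ne M₃))
  have h : ∑ w : Fin M₁ × Fin M₂ × Fin M₃,
      ∑ y, (if C.dec y = w then C.blockRef W k₁ k₂ w.1 w.2.1 y else 0) ≤
        (bif k₁ then (M₁ : ℝ) else 1) * (bif k₂ then (M₂ : ℝ) else 1) := by
    cases k₁ <;> cases k₂
    · refine (sum_ite_eq_le_card C.dec (fun _ => ())
        fun _ => C.blockRef_mem W false false 0 0).trans ?_
      simp
    · refine (sum_ite_eq_le_card C.dec (fun w => w.2.1)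
        fun j => C.blockRef_mem W false true 0 j).trans ?_
      simp
    · refine (sum_ite_eq_le_card C.dec (fun w => w.1)
        fun i => C.blockRef_mem W true false i 0).trans ?_
      simp
    · refine (sum_ite_eq_le_card C.dec (fun w => (w.1, w.2.1))
        fun z : Fin M₁ × Fin M₂ => C.blockRef_mem W true true z.1 z.2).trans ?_
      simp
  refine (mul_le_mul_of_nonneg_left h (by positivity)).trans (le_of_eq ?_)
  cases k₁ <;> cases k₂ <;> simp only [numUnknown, cond_true, cond_false] <;> field_simp

/-- A form of Fano's inequality for the information of a code. -/
theorem fano (W : Channel 𝒳₁ 𝒳₂ 𝒳₃ 𝒴) (k₁ k₂ : Bool) :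
    (1 - C.errorProb W) * Real.logb 2 (numUnknown M₁ M₂ M₃ k₁ k₂) - 1 / Real.log 2
      ≤ n * C.ensemble.info (W.extend (Fin M₁) (Fin M₂)) k₁ k₂ := by
  have hM₁ : (0 : ℝ) < M₁ := Nat.cast_pos.2 (Nat.pos_of_ne_zero (NeZero.ne M₁))
  have hM₂ : (0 : ℝ) < M₂ := Nat.cast_pos.2 (Nat.pos_of_ne_zero (NeZero.ne M₂))
  have hM₃ : (0 : ℝ) < M₃ := Nat.cast_pos.2 (Nat.pos_of_ne_zero (NeZero.ne M₃))
  have hlog2 : 0 < Real.log 2 := Real.log_pos one_lt_two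
  set N := numUnknown M₁ M₂ M₃ k₁ k₂ with hNdef
  have hN : 0 < N := by
    cases k₁ <;> cases k₂ <;> simp only [hNdef, numUnknown, cond_true, cond_false] <;> positivity
  -- The weight N on correct decoding yields log N times the success probability; the weight 1 on
  -- errors contributes no logarithm.
  refine le_trans ?_ (C.le_info W k₁ k₂ (c := fun w y => if C.dec y = w then N else 1)
    fun w y => by split_ifs <;> [exact hN; exact one_pos])
  have h1 (w : Fin M₁ × Fin M₂ × Fin M₃) :
      ∑ y, W.blockProb (C.enc₁ w.1) (C.enc₂ w.2.1) (C.enc₃ w) y *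
          Real.logb 2 (if C.dec y = w then N else 1)
        = (1 - ∑ y, if C.dec y ≠ w then
            W.blockProb (C.enc₁ w.1) (C.enc₂ w.2.1) (C.enc₃ w) y else 0) * Real.logb 2 N := by
    have hs : ∑ y, W.blockProb (C.enc₁ w.1) (C.enc₂ w.2.1) (C.enc₃ w) y = 1 :=
      (prod_mem_stdSimplex fun q => toReal_mem_stdSimplex
        (W (C.enc₁ w.1 q) (C.enc₂ w.2.1 q) (C.enc₃ w q))).2
    conv_rhs => rw [← hs]
    rw [← Finset.sum_sub_distrib, Finset.sum_mul]
    refine Finset.sum_congr rfl fun y _ => ?_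
    by_cases h : C.dec y = w <;> simp [h]
  -- Only correctly decoded outputs remain, with coefficient 1 - N ≥ -N.
  have h2 (w : Fin M₁ × Fin M₂ × Fin M₃) :
      -(N * ∑ y, (if C.dec y = w then C.blockRef W k₁ k₂ w.1 w.2.1 y else 0)) ≤
        1 - ∑ y, C.blockRef W k₁ k₂ w.1 w.2.1 y * (if C.dec y = w then N else 1) := by
    nth_rw 1 [← (C.blockRef_mem W k₁ k₂ w.1 w.2.1).2]
    rw [← Finset.sum_sub_distrib, Finset.mul_sum,
      ← Finset.sum_neg_distrib]
    refine Finset.sum_le_sum fun y _ => ?_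
    have := (C.blockRef_mem W k₁ k₂ w.1 w.2.1).1 y
    split_ifs <;> nlinarith
  have h3 := C.sum_blockRef_le W k₁ k₂
  rw [← hNdef] at h3
  have h4 := mul_le_mul_of_nonneg_left h3 hN.le
  rw [mul_inv_cancel₀ hN.ne'] at h4
  calc _ ≤ (1 - C.errorProb W) * Real.logb 2 N + (-(N * ((M₁ * M₂ * M₃ : ℝ)⁻¹ *
        ∑ w : Fin M₁ × Fin M₂ × Fin M₃,
          ∑ y, (if C.dec y = w then C.blockRef W k₁ k₂ w.1 w.2.1 y else 0)))) / Real.log 2 := by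
        rw [sub_eq_add_neg, ← neg_div]
        gcongr
    _ = (M₁ * M₂ * M₃ : ℝ)⁻¹ * ∑ w : Fin M₁ × Fin M₂ × Fin M₃,
        ((1 - ∑ y, if C.dec y ≠ w then
            W.blockProb (C.enc₁ w.1) (C.enc₂ w.2.1) (C.enc₃ w) y else 0) * Real.logb 2 N +
          -(N * ∑ y, (if C.dec y = w then C.blockRef W k₁ k₂ w.1 w.2.1 y else 0)) /
            Real.log 2) := by
        rw [errorProb, Finset.sum_add_distrib, ← Finset.sum_mul, Finset.sum_sub_distrib,
          ← Finset.sum_div, Finset.sum_neg_distrib, ← Finset.mul_sum]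
        simp only [Finset.sum_const, Finset.card_univ, Fintype.card_prod, Fintype.card_fin,
          nsmul_eq_mul, Nat.cast_mul, mul_one]
        field_simp
    _ ≤ _ := by
        refine mul_le_mul_of_nonneg_left (Finset.sum_le_sum fun w _ => ?_) (by positivity)
        rw [h1]
        exact add_le_add le_rfl (div_le_div_of_nonneg_right (h2 w) hlog2.le)

end Code

theorem le_logb_numUnknown (R : ℝ × ℝ × ℝ) (n : ℕ) (k₁ k₂ : Bool) :
    n * sumRate R k₁ k₂ ≤ Real.logb 2 (Code.numUnknown (numMessages R.1 n) (numMessages R.2.1 n)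
      (numMessages R.2.2 n) k₁ k₂) := by
  have h (R : ℝ) (k : Bool) :
      (2 : ℝ) ^ (n * bif k then 0 else R) ≤ bif k then 1 else (numMessages R n : ℝ) := by
    cases k
    · exact le_numMessages R n
    · simp
  have h₃ := le_numMessages R.2.2 n
  have key : (2 : ℝ) ^ (n * sumRate R k₁ k₂) ≤ Code.numUnknown (numMessages R.1 n)
      (numMessages R.2.1 n) (numMessages R.2.2 n) k₁ k₂ := by
    simp only [sumRate, mul_add, Real.rpow_add two_pos, Code.numUnknown]
    refine mul_le_mul (mul_le_mul (h _ _) (h _ _) (by positivity) ?_) h₃ (by positivity) ?_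
    · exact (Real.rpow_nonneg zero_le_two _).trans (h _ _)
    · exact mul_nonneg ((Real.rpow_nonneg zero_le_two _).trans (h _ _))
        ((Real.rpow_nonneg zero_le_two _).trans (h _ _))
  rw [Real.le_logb_iff_rpow_le one_lt_two (lt_of_lt_of_le (by positivity) key)]
  exact key

end

/-! ### Scaling and the two inclusions -/

theorem sumRate_smul (c : ℝ) (R : ℝ × ℝ × ℝ) (k₁ k₂ : Bool) :
    sumRate (c • R) k₁ k₂ = c * sumRate R k₁ k₂ := by
  cases k₁ <;> cases k₂ <;> simp [sumRate] <;> ring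

theorem sumRate_nonneg {R : ℝ × ℝ × ℝ} (h₁ : 0 ≤ R.1) (h₂ : 0 ≤ R.2.1) (h₃ : 0 ≤ R.2.2)
    (k₁ k₂ : Bool) : 0 ≤ sumRate R k₁ k₂ := by
  cases k₁ <;> cases k₂ <;> simp only [sumRate, cond_true, cond_false] <;> positivity

theorem mem_closure_of_smul_mem {S : Set (ℝ × ℝ × ℝ)} {R : ℝ × ℝ × ℝ}
    (h : ∀ c : ℝ, 0 ≤ c → c < 1 → c • R ∈ S) : R ∈ closure S := by
  have ht : Tendsto (fun c : ℝ => c • R) (𝓝[<] 1) (𝓝 R) := by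
    have : Tendsto (fun c : ℝ => c • R) (𝓝 1) (𝓝 ((1 : ℝ) • R)) :=
      tendsto_id.smul_const R
    rw [one_smul] at this
    exact this.mono_left nhdsWithin_le_nhds
  refine mem_closure_of_tendsto ht ?_
  filter_upwards [Ico_mem_nhdsLT (zero_lt_one' ℝ)] with c hc using h c hc.1 hc.2

section

variable {𝒳₁ 𝒳₂ 𝒳₃ 𝒴 : Type*} [Fintype 𝒳₁] [Fintype 𝒳₂] [Fintype 𝒳₃] [Fintype 𝒴]

/-- The single-letter rate region, before taking the closure. -/
def Channel.singleLetterRegion (W : Channel 𝒳₁ 𝒳₂ 𝒳₃ 𝒴) : Set (ℝ × ℝ × ℝ) :=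
  {R | 0 ≤ R.1 ∧ 0 ≤ R.2.1 ∧ 0 ≤ R.2.2 ∧
    ∃ (𝒬 𝒰₁ 𝒰₂ : Type) (_ : Fintype 𝒬) (_ : Fintype 𝒰₁) (_ : Fintype 𝒰₂)
      (μ : PMF (Outcome 𝒬 𝒰₁ 𝒳₁ 𝒰₂ 𝒳₂ 𝒳₃ 𝒴)),
      Factorizes W μ ∧ RateBounds μ R.1 R.2.1 R.2.2}

/-- For a positive sum rate the factor c < 1 leaves a slack growing linearly in n, which eventually
exceeds the constant 1 / log 2 and the loss from the error probability. One such block length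
suffices. -/
theorem Channel.smul_mem_singleLetterRegion (W : Channel 𝒳₁ 𝒳₂ 𝒳₃ 𝒴) {R : ℝ × ℝ × ℝ}
    (hR : W.Achievable R) {c : ℝ} (hc0 : 0 ≤ c) (hc1 : c < 1) :
    c • R ∈ W.singleLetterRegion := by
  obtain ⟨h₁, h₂, h₃, C, hC⟩ := hR
  have hev (k₁ k₂ : Bool) : ∀ᶠ n : ℕ in atTop, sumRate R k₁ k₂ = 0 ∨
      1 / Real.log 2 ≤ n * (sumRate R k₁ k₂ * (1 - (C n).errorProb W - c)) := by
    rcases (sumRate_nonneg h₁ h₂ h₃ k₁ k₂).eq_or_lt with h0 | hpos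
    · exact Eventually.of_forall fun n => Or.inl h0.symm
    · have hlim : Tendsto (fun n : ℕ => sumRate R k₁ k₂ * (1 - (C n).errorProb W - c)) atTop
          (𝓝 (sumRate R k₁ k₂ * (1 - 0 - c))) :=
        ((hC.const_sub 1).sub_const c).const_mul _
      have := tendsto_natCast_atTop_atTop (R := ℝ).atTop_mul_pos
        (mul_pos hpos (by linarith)) hlim
      filter_upwards [this.eventually_ge_atTop (1 / Real.log 2)] with n hn using Or.inr hn
  have hall : ∀ᶠ n : ℕ in atTop, 0 < n ∧ (C n).errorProb W < 1 ∧ ∀ k₁ k₂, sumRate R k₁ k₂ = 0 ∨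
      1 / Real.log 2 ≤ n * (sumRate R k₁ k₂ * (1 - (C n).errorProb W - c)) :=
    (eventually_gt_atTop 0).and ((hC.eventually_lt_const zero_lt_one).and
      (eventually_all.2 fun k₁ => eventually_all.2 fun k₂ => hev k₁ k₂))
  obtain ⟨n, hn, hPe, hb⟩ := hall.exists
  have : NeZero n := ⟨hn.ne'⟩
  have : NeZero (numMessages R.1 n) := ⟨(numMessages_pos _ _).ne'⟩
  have : NeZero (numMessages R.2.1 n) := ⟨(numMessages_pos _ _).ne'⟩
  have : NeZero (numMessages R.2.2 n) := ⟨(numMessages_pos _ _).ne'⟩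
  obtain ⟨μ, hμ⟩ := exists_joint W (PMF.uniformOfFintype (Fin n)) (C n).law₁ (C n).law₂ (C n).law₃
  have hind : (C n).ensemble.Induces W μ := induces_ofPMF hμ
  refine ⟨mul_nonneg hc0 h₁, mul_nonneg hc0 h₂, mul_nonneg hc0 h₃, Fin n,
    Fin (numMessages R.1 n), Fin (numMessages R.2.1 n), inferInstance, inferInstance,
    inferInstance, μ,
    ⟨_, _, _, _, hμ⟩, (hind.rateBounds_iff (c • R)).2 fun k₁ k₂ => ?_⟩
  rw [sumRate_smul]
  rcases hb k₁ k₂ with h0 | hb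
  · rw [h0, mul_zero]
    exact (C n).info_ensemble_nonneg W k₁ k₂
  · have hf := (C n).fano W k₁ k₂
    have hl := mul_le_mul_of_nonneg_left (le_logb_numUnknown R n k₁ k₂) (sub_pos.2 hPe).le
    have hn' : (0 : ℝ) < n := Nat.cast_pos.2 hn
    refine le_of_mul_le_mul_left ?_ hn'
    nlinarith

/-- Scaling makes every bound with positive sum rate strict, as random coding requires. -/
theorem Channel.smul_achievable (W : Channel 𝒳₁ 𝒳₂ 𝒳₃ 𝒴) {R : ℝ × ℝ × ℝ}
    (hR : R ∈ W.singleLetterRegion) {c : ℝ} (hc0 : 0 ≤ c) (hc1 : c < 1) :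
    W.Achievable (c • R) := by
  obtain ⟨h₁, h₂, h₃, 𝒬, 𝒰₁, 𝒰₂, _, _, _, μ, ⟨pQ, p₁, p₂, p₃, hμ⟩, hb⟩ := hR
  have hind : (Ensemble.ofPMF pQ p₁ p₂ p₃).Induces W μ := induces_ofPMF hμ
  rw [hind.rateBounds_iff] at hb
  refine achievable_of_lt_info W (Ensemble.ofPMF pQ p₁ p₂ p₃) (mul_nonneg hc0 h₁)
    (mul_nonneg hc0 h₂) (mul_nonneg hc0 h₃) fun k₁ k₂ => ?_
  rw [sumRate_smul]
  rcases (sumRate_nonneg h₁ h₂ h₃ k₁ k₂).eq_or_lt with h0 | hpos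
  · left; rw [← h0, mul_zero]
  · right
    exact (mul_lt_of_lt_one_left hpos hc1).trans_le (hb k₁ k₂)

end

end CogMAC

end

/-- The capacity region of the discrete memoryless multiple access channel with a cognitive
relay. -/
theorem proposition1 {𝒳₁ 𝒳₂ 𝒳₃ 𝒴 : Type*} [Fintype 𝒳₁] [Fintype 𝒳₂] [Fintype 𝒳₃] [Fintype 𝒴]
    (W : CogMAC.Channel 𝒳₁ 𝒳₂ 𝒳₃ 𝒴) :
    W.capacityRegion =
      closure {R : ℝ × ℝ × ℝ |
        0 ≤ R.1 ∧ 0 ≤ R.2.1 ∧ 0 ≤ R.2.2 ∧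
        ∃ (𝒬 𝒰₁ 𝒰₂ : Type) (_ : Fintype 𝒬) (_ : Fintype 𝒰₁) (_ : Fintype 𝒰₂)
          (μ : PMF (CogMAC.Outcome 𝒬 𝒰₁ 𝒳₁ 𝒰₂ 𝒳₂ 𝒳₃ 𝒴)),
          CogMAC.Factorizes W μ ∧ CogMAC.RateBounds μ R.1 R.2.1 R.2.2} := by
  refine Set.Subset.antisymm (closure_minimal (fun R hR => ?_) isClosed_closure)
    (closure_minimal (fun R hR => ?_) isClosed_closure)
  · exact CogMAC.mem_closure_of_smul_mem fun c hc0 hc1 =>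
      W.smul_mem_singleLetterRegion hR hc0 hc1
  · exact CogMAC.mem_closure_of_smul_mem fun c hc0 hc1 => W.smul_achievable hR hc0 hc1
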